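/- Let $n\ge 0$ be an integer and let $F_n$ be the free monoid on letters $x_1,\dots,x_n$ (its elements are called words). Let $=_M$ be the least congruence on $F_n$ such that $$x_ax_b=_M x_bx_a\ (|a-b|>1),\qquad x_ax_a=_M x_a\ (1\le a\le n),$$ $$x_ax_{a-1}x_ax_{a-1}=_M x_{a-1}x_ax_{a-1}=_M x_{a-1}x_ax_{a-1}x_a\ (2\le a\le n),$$ and let $M_n=F_n/{=_M}$ be the corresponding CI monoid. For $1\le b\le a\le n+1$ write $(x_a,x_b]=x_{a-1}x_{a-2}\cdots x_b$ (the empty word if $a=b$). Consider the following rewrite rules on words: (a) $x_ax_b\to x_bx_a$ whenever $a-b\ge 2$ (with $1\le a,b\le n$); (b) $(x_a,x_b](x_a,x_b]\to(x_{a-1},x_b](x_a,x_b]$ whenever $1\le b<a\le n+1$; (c) $x_a(y_{a+1}x_{a+1}x_az_{a+1})\cdots(y_bx_bx_{b-1}z_b)\,x_b\to x_a(y_{a+1}x_{a+1}x_az_{a+1})\cdots(y_bx_bx_{b-1}z_b)$ whenever $1\le a\le b\le n$ and, for $a<i\le b$, $y_i$ is a word in the letters $x_{i+1},\dots,x_n$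 and $z_i$ is a word in the letters $x_1,\dots,x_{i-2}$. A word is called $M$-reduced if none of its factors is the left-hand side of one of these rules. An $M$-reduced form of a word $w$ is an $M$-reduced word $u$ with $u=_M w$. Then, for every fixed $n$: 1. Every word $w\in F_n$ has exactly one $M$-reduced form, and there is a polynomial-time algorithm (a multi-stack Turing machine whose number of steps is bounded by a polynomial in the length of $w$) that computes it from $w$. 2. The word problem in $M_n$ is solvable in polynomial time: there is a Turing machine that, given two words $u,v\in F_n$, decides whether $u$ and $v$ represent the same element of $M_n$, in a number of steps bounded by a polynomial in the length of the input. -/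

import Mathlib

namespace CIMonoid

/-- Words: the free monoid `F_n` on letters `x_1, …, x_n`. The letter `x_{i+1}` of the usual
1-based numbering is the generator `FreeMonoid.of i`, `i : Fin n`. -/
abbrev Word (n : ℕ) : Type := FreeMonoid (Fin n)

/-- The letter indexed by `i`, as a word. -/
abbrev x {n : ℕ} (i : Fin n) : Word n := FreeMonoid.of i

/-- Generating pairs of the congruence `=_M`. -/
inductive Rel (n : ℕ) : Word n → Word n → Prop
  /-- `x_a x_b = x_b x_a` if `|a - b| > 1` (the symmetric case follows by symmetry). -/
  | comm (a b : Fin n) (h : (b : ℕ) + 1 < a) : Rel n (x a * x b) (x b * x a)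
  /-- `x_a x_{a-1} x_a x_{a-1} = x_{a-1} x_a x_{a-1}`, with `b = a - 1`. -/
  | left (a b : Fin n) (h : (a : ℕ) = b + 1) :
      Rel n (x a * x b * x a * x b) (x b * x a * x b)
  /-- `x_{a-1} x_a x_{a-1} x_a = x_{a-1} x_a x_{a-1}`, with `b = a - 1`. -/
  | right (a b : Fin n) (h : (a : ℕ) = b + 1) :
      Rel n (x b * x a * x b * x a) (x b * x a * x b)
  /-- `x_a x_a = x_a`. -/
  | idem (a : Fin n) : Rel n (x a * x a) (x a)

/-- The congruence `=_M` on `F_n`. -/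
def con (n : ℕ) : Con (Word n) := conGen (Rel n)

/-- The CI monoid `M_n`, the quotient of `F_n` by `=_M`. -/
abbrev M (n : ℕ) : Type := (con n).Quotient

/-- The element of `M_n` represented by a word. -/
def toM {n : ℕ} : Word n →* M n := (con n).mk'

/-- The decreasing run: the product of all letters with index `i` in `b ≤ i < a`, in decreasing
order. It is empty if `b = a`. -/
def run (n a b : ℕ) : Word n :=
  FreeMonoid.ofList
    ((List.finRange n).filter (fun i : Fin n => b ≤ (i : ℕ) ∧ (i : ℕ) < a)).reverse

/-- `Ladder a b w` says that `w` has the form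
`x_a (y_{a+1} x_{a+1} x_a z_{a+1}) (y_{a+2} x_{a+2} x_{a+1} z_{a+2}) ⋯ (y_b x_b x_{b-1} z_b)`,
where `a ≤ b`, every `y_i` is a word in letters of index greater than `i`, and every `z_i` is a
word in letters of index less than `i - 1`. -/
inductive Ladder {n : ℕ} (a : Fin n) : Fin n → Word n → Prop
  | base : Ladder a a (x a)
  | step {b c : Fin n} {w y z : Word n} (hw : Ladder a b w) (hc : (c : ℕ) = b + 1)
      (hy : y ∈ Submonoid.closure (FreeMonoid.of '' {j : Fin n | c < j}))
      (hz : z ∈ Submonoid.closure (FreeMonoid.of '' {j : Fin n | j < b})) :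
      Ladder a c (w * (y * x c * x b * z))

/-- The elementary rewrite rules. -/
inductive Rule (n : ℕ) : Word n → Word n → Prop
  | comm (a b : Fin n) (h : (b : ℕ) + 2 ≤ a) : Rule n (x a * x b) (x b * x a)
  | double (a b : ℕ) (hb : b ≤ a) (ha : a + 1 ≤ n) :
      Rule n (run n (a + 1) b * run n (a + 1) b) (run n a b * run n (a + 1) b)
  | ladder (a b : Fin n) (w : Word n) (hw : Ladder a b w) : Rule n (w * x b) w

/-- One rewriting step: an elementary rule applied to a factor of the word. -/
inductive Step {n : ℕ} : Word n → Word n → Prop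
  | mk (p u v q : Word n) (h : Rule n u v) : Step (p * u * q) (p * v * q)

/-- A word is `M`-reduced if no rewriting step applies to it. -/
def IsReduced {n : ℕ} (u : Word n) : Prop := ¬ ∃ v, Step u v

/-- `u` is an `M`-reduced form of `w`. -/
def IsReducedForm {n : ℕ} (u w : Word n) : Prop := IsReduced u ∧ con n u w

/-- The tape encoding of a word: the list of its letters. -/
def encodeWord {n : ℕ} (w : Word n) : List (Fin n) := FreeMonoid.toList w

/-- The tape encoding of a pair of words: both words, separated by the extra symbol `none`. -/
def encodePair {n : ℕ} (p : Word n × Word n) : List (Option (Fin n)) :=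
  (encodeWord p.1).map some ++ none :: (encodeWord p.2).map some

/-- `f` is computed by a multi-stack Turing machine (finitely many states, labels and stacks; only
finitely many symbols can ever be pushed, as a pushed symbol is determined by the state and the
program) that halts within a polynomial number of steps in the length of the encoded input. -/
def PolyTime {α β αΓ βΓ : Type} (ea : α → List αΓ) (eb : β → List βΓ) (f : α → β) : Prop :=
  Nonempty (Turing.TM2ComputableInPolyTime ea eb f)

end CIMonoid

/-! All relations of `M n` other than commutation say that a letter is absorbed: by a neighbouring
equal letter, or `x_{b+1}` by a factor `x_b x_{b+1} x_b` before or after it. So the congruence is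
generated by exchanges of commuting letters (`Swap`) and by deletions of letters absorbed by the
whole prefix or the whole suffix (`Kill`). Absorption by a prefix is measured in `RightMonoid`,
which has only one of the two cubic relations; absorption by a suffix is the same notion for the
reversed word.

One-sided absorption is recognised by an automaton. Its state depends only on the element of
`RightMonoid`, and its verdicts are sound (`Claim`), which gives `absorbs_iff`.

Deletions shorten words, so their confluence modulo exchanges reduces to two deletions from one
word. On the same side this is easy. The real case is `p c m d q` with `d` absorbed by `p c m` and
`c` by `m d q`, where each letter may need the other. Following the automaton from both ends
(`outcome_of`) shows that each letter is absorbed without the other, or that `c = d` and the two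
copies can be exchanged, possibly after deleting one letter `x_{c-1}` between them
(`InvariantBelow.crossing`). Hence `traceNF` is an invariant of the congruence.

A class modulo exchanges contains exactly one word without a factor `x_a x_b`, `a ≥ b + 2`. In such
a word the first absorption met from the left exhibits a ladder, rule (c), and the first one met
from the right a doubled run, rule (b). So the `M`-reduced words are the normal ones
(`IsReduced.normal`, `Normal.isReduced`), and they are unique in their classes.

For fixed `n` the automaton is finite. Scanning in both directions until nothing is deleted and then
insertion sorting takes quadratic time on a stack machine. For the word problem, two words are
normalized together, with a separator between them, and compared. -/

namespace CIMonoid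

/-! ### The one-sided monoid and its absorption automaton -/

/-- Defining relations of the one-sided variant of the CI monoid, on infinitely many letters. -/
inductive RightRel : FreeMonoid ℕ → FreeMonoid ℕ → Prop
  | comm (a b : ℕ) (h : b + 2 ≤ a) :
      RightRel (.of a * .of b) (.of b * .of a)
  | idem (a : ℕ) : RightRel (.of a * .of a) (.of a)
  | right (b : ℕ) : RightRel (.of b * .of (b + 1) * .of b * .of (b + 1))
      (.of b * .of (b + 1) * .of b)

/-- The monoid presented by `RightRel`. -/
abbrev RightMonoid : Type := PresentedMonoid RightRel

/-- The generators of `RightMonoid`. -/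
def gen (i : ℕ) : RightMonoid := PresentedMonoid.of RightRel i

/-- The element of `RightMonoid` represented by a list of letters. -/
def val (w : List ℕ) : RightMonoid := (w.map gen).prod

/-- Two letters commute if their indices differ by at least two. -/
def Far (a b : ℕ) : Prop := a + 2 ≤ b ∨ b + 2 ≤ a

theorem Far.symm {a b : ℕ} (h : Far a b) : Far b a := Or.symm h

@[simp] theorem val_nil : val [] = 1 := rfl

@[simp] theorem val_cons (a : ℕ) (w : List ℕ) : val (a :: w) = gen a * val w := by
  simp [val]

@[simp] theorem val_append (u w : List ℕ) : val (u ++ w) = val u * val w := by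
  simp [val]

theorem gen_comm {a b : ℕ} (h : Far a b) : gen a * gen b = gen b * gen a := by
  have key : ∀ a b : ℕ, b + 2 ≤ a → gen a * gen b = gen b * gen a := fun a b h =>
    (Con.eq _).2 (ConGen.Rel.of _ _ (RightRel.comm a b h))
  rcases h with h | h
  · exact (key b a h).symm
  · exact key a b h

theorem gen_idem (a : ℕ) : gen a * gen a = gen a :=
  (Con.eq _).2 (ConGen.Rel.of _ _ (RightRel.idem a))

theorem gen_right (b : ℕ) :
    gen b * gen (b + 1) * gen b * gen (b + 1) = gen b * gen (b + 1) * gen b :=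
  (Con.eq _).2 (ConGen.Rel.of _ _ (RightRel.right b))

/-- The state of the absorption automaton: the set of pairs `(l, i)` such that the word read so far
equals `P x_{l+1} ⋯ x_i` in `RightMonoid` for some `P` with `P x_l = P`. -/
abbrev State : Type := ℕ → ℕ → Prop

/-- The state after a letter `e` that is not absorbed. -/
def pull (s : State) (e : ℕ) : State := fun l i =>
  -- The letter `x_i` starts a new run or prolongs one ending in `i - 1`; the truncated `i - 1` at
  -- `i = 0` is harmless since `l ≤ i`. The letter `x_{l-1}` moves back to `x_l` and lifts a pair
  -- `(l - 1, i)`. Any other letter must commute with all of `x_l, …, x_i`.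
  l ≤ i ∧ if e = i then l = i ∨ s l (i - 1)
    else if e + 1 = l then s e i
    else (e + 1 < l ∨ i + 1 < e) ∧ s l i

open Classical in
/-- The transition of the absorption automaton. -/
noncomputable def step (s : State) (e : ℕ) : State := if s e e then s else pull s e

theorem step_of_pos {s : State} {e : ℕ} (h : s e e) : step s e = s := if_pos h

theorem step_of_neg {s : State} {e : ℕ} (h : ¬ s e e) : step s e = pull s e := if_neg h

theorem step_self (s : State) (e : ℕ) : step s e e e := by
  by_cases h : s e e
  · rwa [step_of_pos h]
  · rw [step_of_neg h]; simp [pull]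

theorem pull_far {s : State} {a b : ℕ} (h : Far a b) : pull s b a a ↔ s a a := by
  unfold Far at h
  unfold pull
  rw [if_neg (by omega), if_neg (by omega)]
  constructor
  · exact fun h => h.2.2
  · exact fun h' => ⟨le_rfl, by omega, h'⟩

theorem step_far {s : State} {a b : ℕ} (h : Far a b) : step s b a a ↔ s a a := by
  by_cases hb : s b b
  · rw [step_of_pos hb]
  · rw [step_of_neg hb, pull_far h]

theorem pull_comm (s : State) {a b : ℕ} (h : a + 2 ≤ b) :
    pull (pull s a) b = pull (pull s b) a := by
  funext l i
  unfold pull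
  apply propext
  grind

theorem step_comm (s : State) {a b : ℕ} (h : Far a b) :
    step (step s a) b = step (step s b) a := by
  by_cases ha : s a a <;> by_cases hb : s b b
  · simp only [step_of_pos, ha, hb]
  · rw [step_of_pos ha, step_of_pos ((step_far h).2 ha)]
  · rw [step_of_pos hb, step_of_pos ((step_far h.symm).2 hb)]
  · rw [step_of_neg (s := step s a) (by rwa [step_far h.symm]),
      step_of_neg (s := step s b) (by rwa [step_far h]), step_of_neg ha, step_of_neg hb]
    rcases h with h | h
    · exact pull_comm s h
    · exact (pull_comm s h).symm

/-- If the second `b` is absorbed, the state is still the one after `b + 1`, which absorbs `b + 1`.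
Otherwise `b + 1` was not absorbed either, and the state passes through the pairs `(b, b)`, `(b, b +
1)`, `(b + 1, b + 1)`. -/
theorem step_right (s : State) (b : ℕ) :
    step (step (step (step s b) (b + 1)) b) (b + 1) = step (step (step s b) (b + 1)) b := by
  apply step_of_pos
  by_cases h : step (step s b) (b + 1) b b
  · rw [step_of_pos h]
    exact step_self _ _
  · rw [step_of_neg h]
    have h1 : ¬ step s b (b + 1) (b + 1) := fun h1 => by
      rw [step_of_pos h1] at h
      exact h (step_self _ _)
    rw [step_of_neg h1]
    simp [pull, step_self]

/-- The action of `RightMonoid` on states. -/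
noncomputable def act : RightMonoid →* (Function.End State)ᵐᵒᵖ :=
  PresentedMonoid.lift (rels := RightRel)
    (fun e => MulOpposite.op (show Function.End State from fun s => step s e)) (by
    intro u v h
    have key : ∀ f g : Function.End State, (∀ s, f s = g s) → MulOpposite.op f = MulOpposite.op g :=
      fun f g h => congrArg _ (funext h)
    cases h with
    | comm a b h => exact key _ _ fun s => step_comm s (Or.inr h)
    | idem a => exact key _ _ fun s => step_of_pos (step_self s a)
    | right b => exact key _ _ fun s => step_right s b)

/-- The state reached after reading a word. -/
noncomputable def state (w : List ℕ) : State := w.foldl step (fun _ _ => False)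

theorem act_val (w : List ℕ) (s : State) : (act (val w)).unop s = w.foldl step s := by
  induction w generalizing s with
  | nil => simp; rfl
  | cons a w ih =>
    rw [val_cons, map_mul, List.foldl_cons, ← ih]
    rw [show act (gen a) = MulOpposite.op (show Function.End State from fun s => step s a) from
      PresentedMonoid.lift_of _ _]
    rfl

theorem state_congr {u w : List ℕ} (h : val u = val w) : state u = state w := by
  rw [state, state, ← act_val, ← act_val, h]

theorem state_snoc (w : List ℕ) (c : ℕ) : state (w ++ [c]) = step (state w) c := by
  simp [state]

/-! ### Soundness and completeness of the automaton -/

/-- `Claim y l i` says that `y = P x_{l+1} ⋯ x_i` for some `P` with `P x_l = P`. -/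
inductive Claim : RightMonoid → ℕ → ℕ → Prop
  | base {y : RightMonoid} {i : ℕ} (h : y * gen i = y) : Claim y i i
  | snoc {y : RightMonoid} {l i : ℕ} (h : Claim y l i) : Claim (y * gen (i + 1)) l (i + 1)

theorem Claim.le {y : RightMonoid} {l i : ℕ} (h : Claim y l i) : l ≤ i := by
  induction h <;> omega

theorem Claim.absorb {y : RightMonoid} {i : ℕ} (h : Claim y i i) : y * gen i = y := by
  cases h with
  | base h => exact h
  | snoc h => have := h.le; omega

theorem Claim.succ {y : RightMonoid} {l i : ℕ} (h : Claim y l i) (hl : l < i) :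
    Claim y (l + 1) i := by
  induction h with
  | base => omega
  | @snoc y l i h ih =>
    rcases Nat.lt_or_ge l i with h1 | h1
    · exact (ih h1).snoc
    · obtain rfl : l = i := le_antisymm h.le h1
      exact .base (by rw [mul_assoc, gen_idem])

theorem Claim.diag {y : RightMonoid} {l i : ℕ} (h : Claim y l i) : Claim y i i := by
  cases h with
  | base h => exact .base h
  | snoc h => exact .base (by rw [mul_assoc, gen_idem])

theorem Claim.far {y : RightMonoid} {l i : ℕ} (h : Claim y l i) {e : ℕ}
    (he : e + 1 < l ∨ i + 1 < e) : Claim (y * gen e) l i := by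
  induction h with
  | @base y i h =>
    refine .base ?_
    rw [mul_assoc, gen_comm (show Far e i by unfold Far; omega), ← mul_assoc, h]
  | @snoc y l i h ih =>
    have := h.le
    rw [mul_assoc, gen_comm (show Far (i + 1) e by unfold Far; omega), ← mul_assoc]
    exact (ih (by omega)).snoc

/-- The new `x_l` commutes back to `x_{l+1}`, and `P x_{l+1} x_l` absorbs `x_{l+1}`, because `P = P
x_l` supplies the missing first letter of `x_l x_{l+1} x_l x_{l+1} = x_l x_{l+1} x_l`. -/
theorem Claim.rung {y : RightMonoid} {l i : ℕ} (h : Claim y l i) (hl : l + 1 ≤ i) :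
    Claim (y * gen l) (l + 1) i := by
  induction h with
  | base => omega
  | @snoc y l i h ih =>
    rcases Nat.lt_or_ge l i with h1 | h1
    · rw [mul_assoc, gen_comm (show Far (i + 1) l by unfold Far; omega), ← mul_assoc]
      exact (ih h1).snoc
    · obtain rfl : l = i := le_antisymm h.le h1
      have h2 := h.absorb
      refine .base ?_
      calc y * gen (l + 1) * gen l * gen (l + 1)
          = y * (gen l * gen (l + 1) * gen l * gen (l + 1)) := by
            conv_lhs => rw [← h2]
            simp only [mul_assoc]
        _ = y * gen (l + 1) * gen l := by
            rw [gen_right]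
            conv_rhs => rw [← h2]
            simp only [mul_assoc]

/-- One step of the automaton preserves soundness, even for letters that could be skipped. -/
theorem Claim.of_pull {y : RightMonoid} {s : State} {e l i : ℕ}
    (hs : pull s e l i)
    (h1 : e = i → l < i → s l (i - 1) → Claim y l (i - 1))
    (h2 : e + 1 = l → s e i → Claim y e i)
    (h3 : (e + 1 < l ∨ i + 1 < e) → s l i → Claim y l i) :
    Claim (y * gen e) l i := by
  obtain ⟨hli, hs⟩ := hs
  split_ifs at hs with c1 c2
  · subst c1
    rcases Nat.lt_or_ge l e with h | h
    · obtain ⟨e, rfl⟩ : ∃ k, e = k + 1 := ⟨e - 1, by omega⟩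
      exact (h1 rfl h (hs.resolve_left (by omega))).snoc
    · obtain rfl : l = e := le_antisymm hli h
      exact .base (by rw [mul_assoc, gen_idem])
  · subst c2
    exact (h2 rfl hs).rung hli
  · exact (h3 hs.1 hs.2).far hs.1

theorem Claim.of_step {y : RightMonoid} {s : State} (h : ∀ l i, s l i → Claim y l i) (e : ℕ) :
    ∀ l i, step s e l i → Claim (y * gen e) l i := by
  intro l i
  by_cases he : s e e
  · rw [step_of_pos he, (h _ _ he).absorb]
    exact h l i
  · rw [step_of_neg he]
    exact fun hs => .of_pull hs (fun _ _ => h _ _) (fun _ => h _ _) (fun _ => h _ _)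

theorem Claim.of_foldl (w : List ℕ) {y : RightMonoid} {s : State}
    (h : ∀ l i, s l i → Claim y l i) :
    ∀ l i, w.foldl step s l i → Claim (y * val w) l i := by
  induction w generalizing y s with
  | nil => simpa using h
  | cons a w ih =>
    rw [List.foldl_cons, val_cons, ← mul_assoc]
    exact ih (Claim.of_step h a)

theorem Claim.of_state {w : List ℕ} {l i : ℕ} (h : state w l i) : Claim (val w) l i := by
  have := Claim.of_foldl w (y := 1) (s := fun _ _ => False) (by simp) l i h
  rwa [one_mul] at this

/-- `w` absorbs the letter `c` on the right. -/
def Absorbs (w : List ℕ) (c : ℕ) : Prop := val w * gen c = val w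

/-- Completeness needs no normal forms: the state depends only on the element represented, and a
letter just read is always absorbed. -/
theorem absorbs_iff {w : List ℕ} {c : ℕ} : Absorbs w c ↔ state w c c := by
  refine ⟨fun h => ?_, fun h => (Claim.of_state h).absorb⟩
  have h1 : state (w ++ [c]) = state w := state_congr (by simpa using show val w * gen c = val w from h)
  rw [← h1, state_snoc]
  exact step_self _ _

theorem absorbs_snoc_far {w : List ℕ} {c a : ℕ} (h : Far c a) :
    Absorbs (w ++ [a]) c ↔ Absorbs w c := by
  rw [absorbs_iff, absorbs_iff, state_snoc, step_far h]

theorem absorbs_append_far {w m : List ℕ} {c : ℕ} (h : ∀ a ∈ m, Far c a) :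
    Absorbs (w ++ m) c ↔ Absorbs w c := by
  induction m using List.reverseRecOn with
  | nil => simp
  | append_singleton m a ih =>
    rw [← List.append_assoc, absorbs_snoc_far (h a (by simp)), ih fun b hb => h b (by simp [hb])]

theorem absorbs_congr {u w : List ℕ} {c : ℕ} (h : val u = val w) : Absorbs u c ↔ Absorbs w c := by
  unfold Absorbs; rw [h]

/-! ### Deletions and exchanges -/

/-- Deletion of a letter that is absorbed by the prefix before it or by the suffix after it. -/
inductive Kill : List ℕ → List ℕ → Prop
  | right (p : List ℕ) (c : ℕ) (q : List ℕ) (h : Absorbs p c) : Kill (p ++ c :: q) (p ++ q)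
  | left (p : List ℕ) (c : ℕ) (q : List ℕ) (h : Absorbs q.reverse c) : Kill (p ++ c :: q) (p ++ q)

/-- Exchange of two adjacent commuting letters. -/
inductive Swap : List ℕ → List ℕ → Prop
  | mk (p : List ℕ) (a b : ℕ) (q : List ℕ) (h : Far a b) : Swap (p ++ a :: b :: q) (p ++ b :: a :: q)

theorem Kill.length {u v : List ℕ} (h : Kill u v) : v.length + 1 = u.length := by
  cases h <;> simp <;> omega

theorem Swap.length {u v : List ℕ} (h : Swap u v) : v.length = u.length := by
  cases h; simp

theorem Kill.reverse {u v : List ℕ} (h : Kill u v) : Kill u.reverse v.reverse := by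
  cases h with
  | right p c q h => simpa using Kill.left q.reverse c p.reverse (by simpa using h)
  | left p c q h => simpa using Kill.right q.reverse c p.reverse (by simpa using h)

theorem Swap.reverse {u v : List ℕ} (h : Swap u v) : Swap u.reverse v.reverse := by
  cases h with
  | mk p a b q h => simpa using Swap.mk q.reverse b a p.reverse h.symm

/-! ### Two deletions that cross -/

section crossing

variable {c d : ℕ} {q : List ℕ}

theorem state_reverse_cons (e : ℕ) (l : List ℕ) :
    state (e :: l).reverse = step (state l.reverse) e := by
  rw [List.reverse_cons, state_snoc]

/-- No letter of `m`, read from the state `s` and followed by `r`, is absorbed from the left or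
from the right. -/
def Rigid : State → List ℕ → List ℕ → Prop
  | _, [], _ => True
  | s, e :: m, r => ¬ s e e ∧ ¬ state (m ++ r).reverse e e ∧ Rigid (step s e) m r

theorem rigid_of {s : State} {m r : List ℕ}
    (h : ∀ m₁ e m₂, m = m₁ ++ e :: m₂ →
      ¬ m₁.foldl step s e e ∧ ¬ state (m₂ ++ r).reverse e e) : Rigid s m r := by
  induction m generalizing s with
  | nil => trivial
  | cons e m ih =>
    have h0 := h [] e m rfl
    refine ⟨h0.1, h0.2, ih fun m₁ e' m₂ hm => ?_⟩
    exact h (e :: m₁) e' m₂ (by rw [hm]; rfl)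

/-- Here `s` has read `c` and `y` has not. The pair `(l, c)`, `l < c`, seen from the right forces
every letter of `m` to be far from `c`: a further `c` would be absorbed, and `c - 1` or `c + 1`
would destroy the pair. Letters far from `c` keep `(c, c)` the only pair ending in `c`, so `d` is
`c` or is absorbed without it. -/
theorem claim_or_far {m : List ℕ} {y : RightMonoid} {s : State} {l : ℕ}
    (hm : Rigid s m (d :: q)) (hs : m.foldl step s d d) (hc : s c c)
    (h1 : ∀ l i, i ≠ c → s l i → Claim y l i) (h2 : ∀ l, s l c → l = c)
    (hl : l < c) (hL : state (m ++ d :: q).reverse l c) :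
    (d = c ∧ ∀ a ∈ m, Far c a) ∨ Claim (y * val m) d d := by
  induction m generalizing y s l with
  | nil =>
    by_cases h : d = c
    · simp [h]
    · exact Or.inr (by simpa using h1 _ _ h hs)
  | cons e m ih =>
    obtain ⟨he, he', hm⟩ := hm
    rw [List.cons_append, state_reverse_cons, step_of_neg he'] at hL
    have hec : e ≠ c := fun h => he (h ▸ hc)
    obtain ⟨l', hl', hL', hfar⟩ :
        ∃ l' < c, state (m ++ d :: q).reverse l' c ∧ Far c e := by
      obtain ⟨-, hL⟩ := hL
      rw [if_neg hec] at hL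
      unfold Far
      split_ifs at hL with h
      · exact ⟨e, by omega, hL, by omega⟩
      · exact ⟨l, hl, hL.2, by omega⟩
    have hfar' := hfar
    unfold Far at hfar'
    have key := ih (y := y * gen e) hm hs ((step_far hfar).2 hc) ?_ ?_ hl' hL'
    · rcases key with ⟨h, hf⟩ | h
      · refine Or.inl ⟨h, fun a ha => ?_⟩
        rcases List.mem_cons.1 ha with rfl | ha
        exacts [hfar, hf a ha]
      · exact Or.inr (by rwa [val_cons, ← mul_assoc])
    · rw [step_of_neg he]
      intro l i hi hp
      exact .of_pull hp (fun _ _ => h1 _ _ (by omega)) (fun _ => h1 _ _ hi) (fun _ => h1 _ _ hi)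
    · rw [step_of_neg he]
      rintro l ⟨-, hp⟩
      rw [if_neg hec] at hp
      split_ifs at hp with h
      · have := h2 _ hp
        omega
      · exact h2 _ hp.2

/-- The possible outcomes when `d` is absorbed after `c` and `m`, while `c` is absorbed by what
follows it. -/
def Outcome (c d : ℕ) (y : RightMonoid) (m : List ℕ) : Prop :=
  (d = c ∧ ∀ a ∈ m, Far c a) ∨
  (d = c ∧ ∃ m₁ b m₂, b + 1 = c ∧ m = m₁ ++ b :: m₂ ∧ Claim (y * val m₁) b b ∧
    (∀ a ∈ m₁, Far c a) ∧ ∀ a ∈ m₂, Far c a) ∨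
  Claim (y * val m) d d

/-- Again `s` has read `c` and `y` has not. Pairs not ending in `c` stay sound for `y`, and pairs
`(l, c)` with `l < c` become sound once `x_c` is dropped from the run. As `(c, c)` is present from
the right, the first letter of `m` that is not far from `c` can only be `c - 1`. -/
theorem outcome_of {m : List ℕ} {y : RightMonoid} {s : State}
    (hm : Rigid s m (d :: q)) (hs : m.foldl step s d d) (hc : s c c)
    (h1 : ∀ l i, i ≠ c → s l i → Claim y l i) (h2 : ∀ l < c, s l c → Claim y l (c - 1))
    (hL : state (m ++ d :: q).reverse c c) : Outcome c d y m := by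
  induction m generalizing y s with
  | nil =>
    by_cases h : d = c
    · exact Or.inl (by simp [h])
    · exact Or.inr (Or.inr (by simpa using h1 _ _ h hs))
  | cons e m ih =>
    obtain ⟨he, he', hm⟩ := hm
    rw [List.cons_append, state_reverse_cons, step_of_neg he'] at hL
    have hec : e ≠ c := fun h => he (h ▸ hc)
    obtain ⟨-, hL⟩ := hL
    rw [if_neg hec] at hL
    split_ifs at hL with heb
    · have h1' : ∀ l i, i ≠ c → step s e l i → Claim (y * gen e) l i := by
        rw [step_of_neg he]
        intro l i hi hp
        exact .of_pull hp (fun _ _ => h1 _ _ (by omega)) (fun _ => h1 _ _ hi)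
          (fun _ => h1 _ _ hi)
      by_cases hsc : s e c
      -- With `(c - 1, c)` in the state, `y` absorbs `c - 1`. After this letter `(c, c)` is the only
      -- pair ending in `c`, as `claim_or_far` requires.
      · have hy : Claim y e e := by
          have := h2 e (by omega) hsc
          rwa [← heb, Nat.add_sub_cancel] at this
        have key := claim_or_far (y := y * gen e) (c := c) hm hs ?_ h1' ?_ (by omega) hL
        · rcases key with ⟨h, hf⟩ | h
          · exact Or.inr (Or.inl ⟨h, [], e, m, heb, rfl, by simpa using hy, by simp, hf⟩)
          · exact Or.inr (Or.inr (by rwa [val_cons, ← mul_assoc]))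
        · rw [step_of_neg he]
          exact ⟨le_rfl, by rwa [if_neg hec, if_pos heb]⟩
        · rw [step_of_neg he]
          rintro l ⟨hl, hp⟩
          rw [if_neg hec] at hp
          split_ifs at hp with h
          · omega
          · omega
      -- Without `(c - 1, c)`, the letter `c - 1` destroys all pairs ending in `c`, so the whole
      -- state is sound for the word without `c`.
      · refine Or.inr (Or.inr ?_)
        rw [val_cons, ← mul_assoc]
        refine Claim.of_foldl m (fun l i hp => ?_) _ _ hs
        by_cases hi : i = c
        · subst hi
          rw [step_of_neg he] at hp
          obtain ⟨hl, hp⟩ := hp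
          rw [if_neg hec] at hp
          split_ifs at hp with h
          · exact absurd hp hsc
          · omega
        · exact h1' l i hi hp
    · have hfar : Far c e := by unfold Far; omega
      have hfar' := hL.1
      have key := ih (y := y * gen e) hm hs ((step_far hfar).2 hc) ?_ ?_ hL.2
      · rcases key with ⟨h, hf⟩ | ⟨h, m₁, b, m₂, hb, rfl, hy, hf, hf'⟩ | h
        · refine Or.inl ⟨h, fun a ha => ?_⟩
          rcases List.mem_cons.1 ha with rfl | ha
          exacts [hfar, hf a ha]
        · refine Or.inr (Or.inl ⟨h, e :: m₁, b, m₂, hb, rfl, ?_, fun a ha => ?_, hf'⟩)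
          · rwa [val_cons, ← mul_assoc]
          · rcases List.mem_cons.1 ha with rfl | ha
            exacts [hfar, hf a ha]
        · exact Or.inr (Or.inr (by rwa [val_cons, ← mul_assoc]))
      · rw [step_of_neg he]
        intro l i hi hp
        exact .of_pull hp (fun _ _ => h1 _ _ (by omega)) (fun _ => h1 _ _ hi) (fun _ => h1 _ _ hi)
      · rw [step_of_neg he]
        rintro l hl ⟨-, hp⟩
        rw [if_neg hec] at hp
        split_ifs at hp with h
        · subst h
          exact (h2 _ (by omega) hp).rung (by omega)
        · exact (h2 _ hl hp.2).far (by omega)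

/-- As `p` does not absorb `c`, each pair `(l, c)`, `l < c`, after `p c` stems from `(l, c - 1)`
after `p`. Pairs not ending in `c` are sound for `p` already, if necessary by `Claim.succ`. -/
theorem outcome_of_absorbs {p m : List ℕ} (hR : Absorbs (p ++ c :: m) d)
    (hL : Absorbs (m ++ d :: q).reverse c) (hc : ¬ Absorbs p c)
    (hm : Rigid (state (p ++ [c])) m (d :: q)) : Outcome c d (val p) m := by
  rw [absorbs_iff] at hR hL hc
  have hstep : state (p ++ [c]) = pull (state p) c := by rw [state_snoc, step_of_neg hc]
  refine outcome_of hm ?_ (by rw [state_snoc]; exact step_self _ _) ?_ ?_ hL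
  · simpa [state] using hR
  · rw [hstep]
    rintro l i hi ⟨hli, h⟩
    rw [if_neg (Ne.symm hi)] at h
    split_ifs at h with h'
    · subst h'
      exact (Claim.of_state h).succ (by omega)
    · exact Claim.of_state h.2
  · rw [hstep]
    rintro l hl ⟨-, h⟩
    rw [if_pos rfl] at h
    exact Claim.of_state (h.resolve_left (by omega))

end crossing

/-! ### Local confluence of deletions -/

/-- `F` does not change under deletions and exchanges in words shorter than `N`. -/
def InvariantBelow {T : Type*} (F : List ℕ → T) (N : ℕ) : Prop :=
  ∀ u v, u.length < N → Kill u v ∨ Swap u v → F u = F v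

section confluence

variable {T : Type*} {F : List ℕ → T} {N : ℕ}

theorem InvariantBelow.of_eq (hF : InvariantBelow F N) {M : ℕ} (h : N = M) :
    InvariantBelow F M := h ▸ hF

theorem InvariantBelow.reverse (hF : InvariantBelow F N) :
    InvariantBelow (fun u => F u.reverse) N := fun u v hu h =>
  hF _ _ (by simpa using hu) (h.imp Kill.reverse Swap.reverse)

theorem InvariantBelow.kill_right (hF : InvariantBelow F N) {p q : List ℕ} {c : ℕ}
    (h : Absorbs p c) (hN : p.length + q.length + 1 < N) : F (p ++ c :: q) = F (p ++ q) :=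
  hF _ _ (by simp; omega) (Or.inl (.right p c q h))

theorem InvariantBelow.kill_left (hF : InvariantBelow F N) {p q : List ℕ} {c : ℕ}
    (h : Absorbs q.reverse c) (hN : p.length + q.length + 1 < N) : F (p ++ c :: q) = F (p ++ q) :=
  hF _ _ (by simp; omega) (Or.inl (.left p c q h))

theorem InvariantBelow.move (hF : InvariantBelow F N) {p m q : List ℕ} {c : ℕ}
    (h : ∀ a ∈ m, Far c a) (hN : p.length + m.length + q.length + 1 < N) :
    F (p ++ c :: (m ++ q)) = F (p ++ (m ++ c :: q)) := by
  induction m generalizing p with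
  | nil => rfl
  | cons a m ih =>
    have h1 := hF _ _ (by simp at hN ⊢; omega) (Or.inr (Swap.mk p c a (m ++ q) (h a (by simp))))
    have h2 := ih (p := p ++ [a]) (fun b hb => h b (by simp [hb])) (by simp at hN ⊢; omega)
    simp only [List.append_assoc, List.cons_append, List.nil_append] at h1 h2 ⊢
    rw [h1, h2]

/-- Far letters do not affect the absorption of `c`, and an unabsorbed `c - 1` yields `(c, c)` only
from `(c - 1, c)`, which implies that `c` was absorbed before. -/
theorem absorbs_of_far_cons_far {w m₁ m₂ : List ℕ} {b c : ℕ} (hb : b + 1 = c)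
    (h₁ : ∀ a ∈ m₁, Far c a) (h₂ : ∀ a ∈ m₂, Far c a)
    (h : Absorbs (w ++ (m₁ ++ b :: m₂)) c) : Absorbs w c := by
  have e : w ++ (m₁ ++ b :: m₂) = ((w ++ m₁) ++ [b]) ++ m₂ := by simp
  rw [e, absorbs_append_far h₂, absorbs_iff, state_snoc] at h
  rw [← absorbs_append_far h₁]
  by_cases hs : state (w ++ m₁) b b
  · rwa [step_of_pos hs, ← absorbs_iff] at h
  · rw [step_of_neg hs] at h
    obtain ⟨-, h⟩ := h
    rw [if_neg (by omega), if_pos hb] at h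
    exact (Claim.of_state h).diag.absorb

/-- `outcome_of_absorbs` is applied to the word and to its reverse. If `m` commutes with `c = d`,
one copy slides to the place of the other. If `c - 1` obstructs on both readings, it can be deleted
from both words first. If `c` and `d` are absorbed without each other, the survivor is deleted in
either word. The remaining combinations would make `p` absorb `c` or `q` absorb `d`. -/
theorem InvariantBelow.crossing {p m q : List ℕ} {c d : ℕ}
    (hF : InvariantBelow F (p.length + m.length + q.length + 2))
    (hR : Absorbs (p ++ c :: m) d) (hL : Absorbs (m ++ d :: q).reverse c)
    (hc : ¬ Absorbs p c) (hd : ¬ Absorbs q.reverse d)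
    (hm : ∀ m₁ e m₂, m = m₁ ++ e :: m₂ →
      ¬ Absorbs (p ++ c :: m₁) e ∧ ¬ Absorbs (m₂ ++ d :: q).reverse e) :
    F (p ++ (m ++ d :: q)) = F (p ++ c :: (m ++ q)) := by
  have o1 : Outcome c d (val p) m := by
    refine outcome_of_absorbs hR hL hc (rigid_of fun m₁ e m₂ h => ?_)
    simpa [absorbs_iff, state] using hm m₁ e m₂ h
  have o2 : Outcome d c (val q.reverse) m.reverse := by
    refine outcome_of_absorbs (q := p.reverse) (by simpa using hL) (by simpa using hR) hd
      (rigid_of fun m₁ e m₂ h => ?_)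
    have := hm m₂.reverse e m₁.reverse (by rw [← List.reverse_reverse m, h]; simp)
    simpa [absorbs_iff, state, and_comm] using this
  rcases o1 with ⟨rfl, hf⟩ | ⟨rfl, m₁, b, m₂, hb, rfl, hy, hf₁, hf₂⟩ | o1
  · exact (hF.move hf (by omega)).symm
  · rcases o2 with ⟨-, hf⟩ | ⟨-, n₁, b', n₂, hb', hn, hy', hg₁, hg₂⟩ | o2
    · exact (hF.move (fun a ha => hf a (List.mem_reverse.2 ha)) (by omega)).symm
    · obtain rfl : b = b' := by omega
      have hnot : ∀ l : List ℕ, (∀ a ∈ l, Far d a) → b ∉ l := fun l hl hbl => by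
        have := hl b hbl
        unfold Far at this
        omega
      have hn' : m₂.reverse ++ b :: m₁.reverse = n₁ ++ b :: n₂ := by simpa using hn
      -- The letter `b = d - 1` is not far from `d`, so it occurs only once in `m` and the two
      -- decompositions agree.
      obtain ⟨rfl, -, -⟩ := (List.append_cons_inj_of_notMem
        (hnot _ fun a ha => hf₂ a (by simpa using ha))
        (hnot _ fun a ha => hf₁ a (by simpa using ha))).1 hn'
      simp only [List.length_append, List.length_cons] at hF
      have k1 := hF.kill_right (p := p ++ m₁) (c := b) (q := m₂ ++ d :: q)
        (by simpa [Absorbs] using hy.absorb) (by simp; omega)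
      have k2 := hF.kill_left (p := p ++ d :: m₁) (c := b) (q := m₂ ++ q)
        (by simpa [Absorbs] using hy'.absorb) (by simp; omega)
      have k3 := hF.move (p := p) (m := m₁ ++ m₂) (q := q) (c := d)
        (fun a ha => (List.mem_append.1 ha).elim (hf₁ a) (hf₂ a)) (by simp)
      simp only [List.append_assoc, List.cons_append] at k1 k2 k3 ⊢
      rw [k1, k2, k3]
    · refine absurd (absorbs_of_far_cons_far (w := q.reverse) (m₁ := m₂.reverse)
        (m₂ := m₁.reverse) hb (fun a ha => hf₂ a (by simpa using ha))
        (fun a ha => hf₁ a (by simpa using ha)) ?_) hd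
      simpa [Absorbs] using o2.absorb
  · rcases o2 with ⟨rfl, hf⟩ | ⟨rfl, n₁, b, n₂, hb, hn, hy, hf₁, hf₂⟩ | o2
    · exact (hF.move (fun a ha => hf a (by simpa using ha)) (by omega)).symm
    · refine absurd (absorbs_of_far_cons_far (w := p) (m₁ := n₂.reverse)
        (m₂ := n₁.reverse) hb (fun a ha => hf₂ a (by simpa using ha))
        (fun a ha => hf₁ a (by simpa using ha)) ?_) hc
      have : m = n₂.reverse ++ b :: n₁.reverse := by rw [← List.reverse_reverse m, hn]; simp
      rw [← this]
      simpa [Absorbs] using o1.absorb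
    · have k1 := hF.kill_right (p := p ++ m) (c := d) (q := q)
        (by simpa [Absorbs] using o1.absorb) (by simp)
      have k2 := hF.kill_left (p := p) (c := c) (q := m ++ q)
        (by simpa [Absorbs] using o2.absorb) (by simp; omega)
      rw [← List.append_assoc, k1, k2, List.append_assoc]

theorem append_cons_trichotomy {α : Type*} {p₁ q₁ p₂ q₂ : List α} {a b : α}
    (h : p₁ ++ a :: q₁ = p₂ ++ b :: q₂) :
    (p₁ = p₂ ∧ a = b ∧ q₁ = q₂) ∨ (∃ m, p₂ = p₁ ++ a :: m ∧ q₁ = m ++ b :: q₂) ∨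
      ∃ m, p₁ = p₂ ++ b :: m ∧ q₂ = m ++ a :: q₁ := by
  rcases List.append_eq_append_iff.1 h with ⟨m, rfl, hm⟩ | ⟨m, rfl, hm⟩
  · cases m with
    | nil => simp_all
    | cons x m =>
      simp only [List.cons_append, List.cons.injEq] at hm
      exact Or.inr (Or.inl ⟨m, by simp [hm.1], hm.2⟩)
  · cases m with
    | nil => simp_all
    | cons x m =>
      simp only [List.cons_append, List.cons.injEq] at hm
      exact Or.inr (Or.inr ⟨m, by simp [hm.1], hm.2⟩)

/-- Deleting an absorbed letter changes the value of no longer prefix, so the later letter stays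
absorbed. -/
theorem InvariantBelow.right_right {p₁ q₁ p₂ q₂ : List ℕ} {c d : ℕ}
    (hF : InvariantBelow F (p₁ ++ c :: q₁).length) (h : p₁ ++ c :: q₁ = p₂ ++ d :: q₂)
    (h₁ : Absorbs p₁ c) (h₂ : Absorbs p₂ d) : F (p₁ ++ q₁) = F (p₂ ++ q₂) := by
  have key : ∀ (p m q : List ℕ) (c d : ℕ), InvariantBelow F (p ++ c :: (m ++ d :: q)).length →
      Absorbs p c → Absorbs (p ++ c :: m) d →
      F (p ++ (m ++ d :: q)) = F (p ++ c :: m ++ q) := by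
    intro p m q c d hF h₁ h₂
    simp only [List.length_append, List.length_cons] at hF
    have k1 := hF.kill_right (p := p ++ m) (c := d) (q := q)
      ((absorbs_congr (by rw [val_append, val_cons, ← mul_assoc, h₁, val_append])).1 h₂) (by simp; omega)
    have k2 := hF.kill_right (p := p) (c := c) (q := m ++ q) h₁ (by simp; omega)
    simp only [List.append_assoc, List.cons_append] at k1 k2 ⊢
    rw [k1, k2]
  rcases append_cons_trichotomy h with ⟨rfl, rfl, rfl⟩ | ⟨m, rfl, rfl⟩ | ⟨m, rfl, rfl⟩
  · rfl
  · exact key _ _ _ _ _ hF h₁ h₂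
  · exact (key _ _ _ _ _ (by rwa [h] at hF) h₂ h₁).symm

theorem InvariantBelow.left_left {p₁ q₁ p₂ q₂ : List ℕ} {c d : ℕ}
    (hF : InvariantBelow F (p₁ ++ c :: q₁).length) (h : p₁ ++ c :: q₁ = p₂ ++ d :: q₂)
    (h₁ : Absorbs q₁.reverse c) (h₂ : Absorbs q₂.reverse d) : F (p₁ ++ q₁) = F (p₂ ++ q₂) := by
  have := InvariantBelow.right_right (F := fun u => F u.reverse) (p₁ := q₁.reverse)
    (q₁ := p₁.reverse) (p₂ := q₂.reverse) (q₂ := p₂.reverse) (c := c) (d := d)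
    (hF.reverse.of_eq (by simp; omega)) (by simpa using congrArg List.reverse h) h₁ h₂
  simpa using this

/-- Induction on the length of `m`. If some letter `e` of `m` can be deleted, deleting `e` agrees
with deleting one of `c`, `d` by a shorter crossing and with deleting the other by the same-side
case. If `p` absorbs `c` or `q` absorbs `d`, the same-side case suffices; otherwise `crossing`
applies. -/
theorem InvariantBelow.left_right_crossing {p m q : List ℕ} {c d : ℕ}
    (hF : InvariantBelow F (p.length + m.length + q.length + 2))
    (hR : Absorbs (p ++ c :: m) d) (hL : Absorbs (m ++ d :: q).reverse c) :
    F (p ++ (m ++ d :: q)) = F (p ++ c :: (m ++ q)) := by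
  induction hk : m.length using Nat.strong_induction_on generalizing p m q c d with
  | _ k ih =>
  subst hk
  have hlen : (p ++ c :: (m ++ d :: q)).length = p.length + m.length + q.length + 2 := by
    simp; omega
  by_cases hc : Absorbs p c
  · have := InvariantBelow.right_right (hlen ▸ hF)
      (show p ++ c :: (m ++ d :: q) = (p ++ c :: m) ++ d :: q by simp) hc hR
    simpa using this
  by_cases hd : Absorbs q.reverse d
  · have := InvariantBelow.left_left (hlen ▸ hF)
      (show p ++ c :: (m ++ d :: q) = (p ++ c :: m) ++ d :: q by simp) hL hd
    simpa using this
  by_cases hm : ∀ m₁ e m₂, m = m₁ ++ e :: m₂ →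
      ¬ Absorbs (p ++ c :: m₁) e ∧ ¬ Absorbs (m₂ ++ d :: q).reverse e
  · exact hF.crossing hR hL hc hd hm
  push Not at hm
  obtain ⟨m₁, e, m₂, rfl, he⟩ := hm
  by_cases h : Absorbs (p ++ c :: m₁) e
  · have k1 := @ih m₁.length (by simp) p m₁ (m₂ ++ d :: q) c e
      (hF.of_eq (by simp only [List.length_append, List.length_cons]; omega)) h (by simpa using hL) rfl
    have k3 := InvariantBelow.right_right (F := F) (p₁ := p ++ c :: m₁) (c := e)
      (q₁ := m₂ ++ d :: q) (p₂ := p ++ c :: (m₁ ++ e :: m₂)) (d := d) (q₂ := q)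
      (hF.of_eq (by simp only [List.length_append, List.length_cons]; omega)) (by simp) h hR
    simp only [List.append_assoc, List.cons_append] at k1 k3 ⊢
    rw [k1, k3]
  · have h := he h
    have k1 := @ih m₂.length (by simp; omega) (p ++ c :: m₁) m₂ q e d
      (hF.of_eq (by simp only [List.length_append, List.length_cons]; omega)) (by simpa using hR) h rfl
    have k3 := InvariantBelow.left_left (F := F) (p₁ := p) (c := c)
      (q₁ := (m₁ ++ e :: m₂) ++ d :: q) (p₂ := p ++ c :: m₁) (d := e) (q₂ := m₂ ++ d :: q)
      (hF.of_eq (by simp only [List.length_append, List.length_cons]; omega)) (by simp) hL h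
    simp only [List.append_assoc, List.cons_append] at k1 k3 ⊢
    rw [k3, k1]

/-- If `d` stands to the left of `c`, neither deletion touches the prefix or suffix that justifies
the other; if it stands to the right, the deletions cross. -/
theorem InvariantBelow.right_left {p₁ q₁ p₂ q₂ : List ℕ} {c d : ℕ}
    (hF : InvariantBelow F (p₁ ++ d :: q₁).length) (h : p₁ ++ d :: q₁ = p₂ ++ c :: q₂)
    (h₁ : Absorbs p₁ d) (h₂ : Absorbs q₂.reverse c) : F (p₁ ++ q₁) = F (p₂ ++ q₂) := by
  rcases append_cons_trichotomy h with ⟨rfl, rfl, rfl⟩ | ⟨m, rfl, rfl⟩ | ⟨m, rfl, rfl⟩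
  · rfl
  · simp only [List.length_append, List.length_cons] at hF
    have k1 := hF.kill_left (p := p₁ ++ m) (c := c) (q := q₂) h₂ (by simp; omega)
    have k2 := hF.kill_right (p := p₁) (c := d) (q := m ++ q₂) h₁ (by simp; omega)
    simp only [List.append_assoc, List.cons_append] at k1 k2 ⊢
    rw [k1, k2]
  · have := InvariantBelow.left_right_crossing (F := F) (p := p₂) (m := m) (q := q₁) (c := c)
      (d := d) (hF.of_eq (by simp only [List.length_append, List.length_cons]; omega)) h₁ h₂
    simpa using this.symm

theorem InvariantBelow.local_confluence {w u v : List ℕ} (hF : InvariantBelow F w.length)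
    (hu : Kill w u) (hv : Kill w v) : F u = F v := by
  generalize hw : w = w' at hv
  cases hu with
  | right p c q h =>
    cases hv with
    | right p' c' q' h' => exact hF.right_right hw h h'
    | left p' c' q' h' => exact hF.right_left hw h h'
  | left p c q h =>
    cases hv with
    | right p' c' q' h' => exact (InvariantBelow.right_left (hw ▸ hF) hw.symm h' h).symm
    | left p' c' q' h' => exact hF.left_left hw h h'

end confluence

/-! ### Deletion normal forms modulo exchanges -/

theorem Swap.symm {u v : List ℕ} (h : Swap u v) : Swap v u := by
  cases h with
  | mk p a b q h => exact .mk p b a q h.symm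

theorem Swap.val_eq {u v : List ℕ} (h : Swap u v) : val u = val v := by
  cases h with
  | mk p a b q h =>
    simp only [val_append, val_cons]
    rw [← mul_assoc (gen a), gen_comm h, mul_assoc]

/-- An exchange preserves the value of every prefix containing both letters or neither. If one of
the two is the deleted letter, the other is far from it and does not influence its absorption. -/
theorem Swap.kill {u v u' : List ℕ} (h : Swap u v) (hk : Kill u u') :
    ∃ v', Kill v v' ∧ (u' = v' ∨ Swap u' v') := by
  have key : ∀ p a b q p' c q', Far a b → p' ++ c :: q' = p ++ a :: b :: q → Absorbs p' c →
      ∃ v', Kill (p ++ b :: a :: q) v' ∧ (p' ++ q' = v' ∨ Swap (p' ++ q') v') := by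
    intro p a b q p' c q' hab h hc
    rcases append_cons_trichotomy h with ⟨rfl, rfl, rfl⟩ | ⟨m, rfl, rfl⟩ | ⟨m, rfl, hm⟩
    · refine ⟨_, ?_, Or.inl rfl⟩
      simpa using Kill.right (p' ++ [b]) c q ((absorbs_snoc_far hab).2 hc)
    · refine ⟨p' ++ (m ++ b :: a :: q), ?_, Or.inr ?_⟩
      · simpa using Kill.right p' c (m ++ b :: a :: q) hc
      · simpa using Swap.mk (p' ++ m) a b q hab
    · cases m with
      | nil =>
        simp only [List.nil_append, List.cons.injEq] at hm
        obtain ⟨rfl, rfl⟩ := hm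
        refine ⟨p ++ a :: q, Kill.right p b (a :: q) ((absorbs_snoc_far hab.symm).1 hc), Or.inl ?_⟩
        simp
      | cons x m =>
        simp only [List.cons_append, List.cons.injEq] at hm
        obtain ⟨rfl, rfl⟩ := hm
        refine ⟨p ++ b :: a :: (m ++ q'), ?_, Or.inr ?_⟩
        · have := Kill.right (p ++ b :: a :: m) c q' ((absorbs_congr ?_).1 hc)
          · simpa using this
          · simpa using (Swap.mk p a b m hab).val_eq
        · simpa using Swap.mk p a b (m ++ q') hab
  cases hk with
  | right p' c q' hc =>
    generalize hu : p' ++ c :: q' = u at h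
    cases h with
    | mk p a b q hab => exact key p a b q p' c q' hab hu hc
  | left p' c q' hc =>
    generalize hu : p' ++ c :: q' = u at h
    cases h with
    | mk p a b q hab =>
      obtain ⟨v', hv, h⟩ := key q.reverse b a p.reverse q'.reverse c p'.reverse hab.symm
        (by simpa using congrArg List.reverse hu) hc
      refine ⟨v'.reverse, by simpa using hv.reverse, h.imp (fun h => ?_) fun h => ?_⟩
      · simpa using congrArg List.reverse h
      · simpa using h.reverse

open Classical in
/-- The class modulo exchanges of any word that is obtained from `w` by deletions and admits no
further deletion. -/
noncomputable def traceNF (w : List ℕ) : Quot Swap :=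
  if h : ∃ v, Kill w v then traceNF h.choose else Quot.mk _ w
termination_by w.length
decreasing_by have := h.choose_spec.length; omega

theorem traceNF_of_not {w : List ℕ} (h : ¬ ∃ v, Kill w v) : traceNF w = Quot.mk _ w := by
  rw [traceNF, dif_neg h]

/-- Newman's argument modulo exchanges: both invariances are proved together by induction on length,
since local confluence for a word uses both for shorter words. -/
theorem invariantBelow_traceNF (N : ℕ) : InvariantBelow traceNF N := by
  induction N with
  | zero => intro u v h; simp at h
  | succ N ih =>
    have hk : ∀ u v, u.length < N + 1 → Kill u v → traceNF u = traceNF v := by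
      intro u v hu h
      have hex : ∃ v, Kill u v := ⟨v, h⟩
      rw [traceNF, dif_pos hex]
      exact InvariantBelow.local_confluence (fun x y hx => ih x y (by omega)) hex.choose_spec h
    rintro u v hu (h | h)
    · exact hk u v hu h
    · by_cases hex : ∃ u', Kill u u'
      · obtain ⟨u', hu'⟩ := hex
        obtain ⟨v', hv', h'⟩ := h.kill hu'
        rw [hk u u' hu hu', hk v v' (by rw [h.length]; exact hu) hv']
        rcases h' with rfl | h'
        · rfl
        · exact ih _ _ (by have := hu'.length; omega) (Or.inr h')
      · have hex' : ¬ ∃ v', Kill v v' := fun ⟨v', hv'⟩ =>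
          hex ((h.symm.kill hv').imp fun _ h => h.1)
        rw [traceNF_of_not hex, traceNF_of_not hex']
        exact Quot.sound h

theorem Kill.traceNF_eq {u v : List ℕ} (h : Kill u v) : traceNF u = traceNF v :=
  invariantBelow_traceNF _ u v (Nat.lt_succ_self _) (Or.inl h)

theorem Swap.traceNF_eq {u v : List ℕ} (h : Swap u v) : traceNF u = traceNF v :=
  invariantBelow_traceNF _ u v (Nat.lt_succ_self _) (Or.inr h)

/-! ### Descent-free words as normal forms modulo exchanges -/

/-- Insertion of a letter into a stack, below all letters that it has to precede. -/
def insertLetter : List ℕ → ℕ → List ℕ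
  | [], c => [c]
  | t :: u, c => if c + 2 ≤ t then t :: insertLetter u c else c :: t :: u

/-- This makes `sortStack` a function on classes modulo exchanges. -/
theorem insertLetter_comm (u : List ℕ) {a b : ℕ} (h : Far a b) :
    insertLetter (insertLetter u a) b = insertLetter (insertLetter u b) a := by
  have key : ∀ (u : List ℕ) (a b : ℕ), a + 2 ≤ b →
      insertLetter (insertLetter u a) b = insertLetter (insertLetter u b) a := by
    intro u a b h
    induction u with
    | nil => simp [insertLetter, h, show ¬ b + 2 ≤ a by omega]
    | cons t u ih => grind [insertLetter]
  rcases h with h | h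
  · exact key u a b h
  · exact (key u b a h).symm

/-- The lexicographic normal form of a word modulo exchanges, with its last letter on top. -/
def sortStack (w : List ℕ) : List ℕ := w.foldl insertLetter []

theorem Swap.sortStack_eq {u v : List ℕ} (h : Swap u v) : sortStack u = sortStack v := by
  cases h with
  | mk p a b q h => simp [sortStack, insertLetter_comm _ h]

/-- A word is descent-free if no letter is followed by a letter that should precede it. -/
def DescentFree (w : List ℕ) : Prop := w.IsChain fun a b => a ≤ b + 1

theorem DescentFree.sortStack {w : List ℕ} (h : DescentFree w) : sortStack w = w.reverse := by
  induction w using List.reverseRecOn with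
  | nil => rfl
  | append_singleton w c ih =>
    unfold DescentFree at *
    rw [List.isChain_append] at h
    have ih := ih h.1
    rw [CIMonoid.sortStack, List.foldl_append, ← CIMonoid.sortStack, ih]
    simp only [List.foldl_cons, List.foldl_nil, List.reverse_append, List.reverse_cons,
      List.reverse_nil, List.nil_append, List.singleton_append]
    cases hw : w.reverse with
    | nil => rfl
    | cons t u =>
      have : t ≤ c + 1 := h.2.2 t (by rw [List.getLast?_eq_head?_reverse, hw]; simp) c (by simp)
      rw [insertLetter, if_neg (by omega)]

/-- A word is normal if it admits no deletion and is descent-free. -/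
def Normal (w : List ℕ) : Prop := (¬ ∃ v, Kill w v) ∧ DescentFree w

/-- `sortStack` recovers a descent-free word from its class modulo exchanges. -/
theorem Normal.eq {u v : List ℕ} (hu : Normal u) (hv : Normal v) (h : traceNF u = traceNF v) :
    u = v := by
  rw [traceNF_of_not hu.1, traceNF_of_not hv.1] at h
  have := congrArg (Quot.lift sortStack fun _ _ => Swap.sortStack_eq) h
  change sortStack u = sortStack v at this
  rw [hu.2.sortStack, hv.2.sortStack] at this
  exact List.reverse_injective this

theorem insertLetter_isChain {u : List ℕ} (h : u.IsChain fun a b => b ≤ a + 1) (c : ℕ) :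
    (insertLetter u c).IsChain fun a b => b ≤ a + 1 := by
  induction u with
  | nil => simp [insertLetter]
  | cons t u ih =>
    rw [insertLetter]
    split_ifs with hc
    · rw [List.isChain_cons] at h ⊢
      refine ⟨fun y hy => ?_, ih h.2⟩
      cases u with
      | nil => simp [insertLetter] at hy; omega
      | cons t' u =>
        rw [insertLetter] at hy
        split_ifs at hy
        · exact h.1 y hy
        · simp at hy; omega
    · rw [List.isChain_cons_cons]
      exact ⟨by omega, h⟩

theorem descentFree_sortStack (w : List ℕ) : DescentFree (sortStack w).reverse := by
  unfold DescentFree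
  rw [List.isChain_reverse]
  induction w using List.reverseRecOn with
  | nil => simp [sortStack]
  | append_singleton w c ih =>
    rw [sortStack, List.foldl_append, ← sortStack]
    exact insertLetter_isChain ih c

theorem eqvGen_insertLetter (u : List ℕ) (c : ℕ) (v : List ℕ) :
    Relation.EqvGen Swap (u.reverse ++ c :: v) ((insertLetter u c).reverse ++ v) := by
  induction u generalizing v with
  | nil => simpa [insertLetter] using .refl _
  | cons t u ih =>
    rw [insertLetter]
    split_ifs with hc
    · refine .trans _ (u.reverse ++ c :: t :: v) _ (.rel _ _ ?_) ?_
      · simpa using Swap.mk u.reverse t c v (Or.inr hc)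
      · simpa using ih (t :: v)
    · simpa using .refl _

theorem eqvGen_sortStack (w : List ℕ) : Relation.EqvGen Swap w (sortStack w).reverse := by
  have key : ∀ (w u : List ℕ),
      Relation.EqvGen Swap (u.reverse ++ w) (w.foldl insertLetter u).reverse := by
    intro w
    induction w with
    | nil => intro u; simpa using .refl _
    | cons c w ih => exact fun u => .trans _ _ _ (eqvGen_insertLetter u c w) (ih _)
  simpa [sortStack] using key w []

theorem not_kill_of_eqvGen {u v : List ℕ} (h : Relation.EqvGen Swap u v) :
    (∃ u', Kill u u') ↔ ∃ v', Kill v v' := by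
  induction h with
  | rel u v h =>
    exact ⟨fun ⟨_, hu⟩ => (h.kill hu).imp fun _ h => h.1,
      fun ⟨_, hu⟩ => (h.symm.kill hu).imp fun _ h => h.1⟩
  | refl => rfl
  | symm _ _ _ ih => exact ih.symm
  | trans _ _ _ _ _ ih ih' => exact ih.trans ih'

theorem normal_sortStack {w : List ℕ} (h : ¬ ∃ v, Kill w v) : Normal (sortStack w).reverse :=
  ⟨by rwa [← not_kill_of_eqvGen (eqvGen_sortStack w)], descentFree_sortStack w⟩

/-! ### Deletions and exchanges generate the congruence -/

section interpretation

variable {n : ℕ}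

/-- The list of letter indices of a word. -/
def indices (w : Word n) : List ℕ := w.toList.map Fin.val

@[simp] theorem indices_mul (u v : Word n) : indices (u * v) = indices u ++ indices v := by
  simp [indices]

@[simp] theorem indices_one : indices (1 : Word n) = [] := rfl

@[simp] theorem indices_x (i : Fin n) : indices (x i) = [(i : ℕ)] := rfl

theorem indices_injective : Function.Injective (indices (n := n)) := fun _ _ h =>
  FreeMonoid.toList.injective (List.map_injective_iff.2 Fin.val_injective h)

/-- Quantifying over all contexts turns equality of `traceNF` into a congruence, and in every
context each defining relation is a single deletion or exchange. -/
theorem traceNF_eq_of_con {u v : Word n} (h : con n u v) :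
    traceNF (indices u) = traceNF (indices v) := by
  let c : Con (Word n) :=
    { r := fun u v => ∀ p q, traceNF (p ++ indices u ++ q) = traceNF (p ++ indices v ++ q)
      iseqv := ⟨fun _ _ _ => rfl, fun h p q => (h p q).symm, fun h h' p q => (h p q).trans (h' p q)⟩
      mul' := by
        intro u u' v v' h h' p q
        have h1 := h p (indices v ++ q)
        have h2 := h' (p ++ indices u') q
        simp only [indices_mul, List.append_assoc] at h1 h2 ⊢
        rw [h1, h2] }
  have hc : con n ≤ c := Con.conGen_le.2 (by
    intro u v h p q
    cases h with
    | comm a b h =>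
      simpa using (Swap.mk p a b q (Or.inr h)).traceNF_eq
    | left a b h =>
      have := (Kill.left p a (b :: a :: b :: q) (by
        have := gen_right b
        simp only [Absorbs, List.reverse_cons, val_append, val_cons, val_nil, h, mul_assoc,
          mul_one] at this ⊢
        rw [this])).traceNF_eq
      simpa using this
    | right a b h =>
      have := (Kill.right (p ++ [(b : ℕ), a, b]) a q (by
        have := gen_right b
        simp only [Absorbs, val_append, val_cons, val_nil, h, mul_assoc,
          mul_one] at this ⊢
        rw [this])).traceNF_eq
      simpa using this
    | idem a =>
      have := (Kill.right (p ++ [(a : ℕ)]) a q (by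
        simp [Absorbs, mul_assoc, gen_idem])).traceNF_eq
      simpa using this)
  simpa using hc h [] []

/-- The interpretation of an index in `M n`; indices that are out of range go to `1`. -/
def letter (n : ℕ) (i : ℕ) : M n := if h : i < n then toM (x ⟨i, h⟩) else 1

theorem toM_eq_iff {u v : Word n} : toM u = toM v ↔ con n u v := Con.eq _

theorem toM_of_rel {u v : Word n} (h : Rel n u v) : toM u = toM v :=
  toM_eq_iff.2 (ConGen.Rel.of _ _ h)

theorem letter_comm {a b : ℕ} (h : b + 2 ≤ a) : letter n a * letter n b = letter n b * letter n a := by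
  unfold letter
  split_ifs with ha hb
  · simpa using toM_of_rel (Rel.comm ⟨a, ha⟩ ⟨b, hb⟩ h)
  all_goals simp

theorem letter_idem (a : ℕ) : letter n a * letter n a = letter n a := by
  unfold letter
  split_ifs with ha
  · simpa using toM_of_rel (Rel.idem ⟨a, ha⟩)
  · simp

theorem letter_right (b : ℕ) : letter n b * letter n (b + 1) * letter n b * letter n (b + 1) =
    letter n b * letter n (b + 1) * letter n b := by
  by_cases h : b + 1 < n
  · simpa [letter, h, show b < n by omega] using
      toM_of_rel (Rel.right ⟨b + 1, h⟩ ⟨b, by omega⟩ rfl)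
  · simp [letter, h]

theorem letter_left (b : ℕ) : letter n (b + 1) * letter n b * letter n (b + 1) * letter n b =
    letter n b * letter n (b + 1) * letter n b := by
  by_cases h : b + 1 < n
  · simpa [letter, h, show b < n by omega] using
      toM_of_rel (Rel.left ⟨b + 1, h⟩ ⟨b, by omega⟩ rfl)
  · simp [letter, h]

/-- The homomorphism from `RightMonoid` that interprets indices in `M n`. -/
def toMRight (n : ℕ) : RightMonoid →* M n :=
  PresentedMonoid.lift (rels := RightRel) (letter n) (by
    intro u v h
    cases h with
    | comm a b h => simp only [map_mul, FreeMonoid.lift_eval_of]; exact letter_comm h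
    | idem a => simp only [map_mul, FreeMonoid.lift_eval_of]; exact letter_idem a
    | right b => simp only [map_mul, FreeMonoid.lift_eval_of]; exact letter_right b)

/-- The anti-homomorphism from `RightMonoid` that interprets indices in `M n`. -/
def toMLeft (n : ℕ) : RightMonoid →* (M n)ᵐᵒᵖ :=
  PresentedMonoid.lift (rels := RightRel) (fun i => MulOpposite.op (letter n i)) (by
    intro u v h
    apply MulOpposite.unop_injective
    cases h with
    | comm a b h =>
      simp only [map_mul, FreeMonoid.lift_eval_of]
      exact (letter_comm h).symm
    | idem a =>
      simp only [map_mul, FreeMonoid.lift_eval_of]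
      exact letter_idem a
    | right b =>
      simp only [map_mul, FreeMonoid.lift_eval_of, MulOpposite.unop_mul, MulOpposite.unop_op]
      simp only [← mul_assoc]
      exact letter_left b)

/-- The element of `M n` represented by a list of indices. -/
def valM (n : ℕ) (w : List ℕ) : M n := (w.map (letter n)).prod

theorem toMRight_val (w : List ℕ) : toMRight n (val w) = valM n w := by
  simp only [val, map_list_prod, List.map_map, valM]
  rfl

theorem toMLeft_val (w : List ℕ) : (toMLeft n (val w)).unop = valM n w.reverse := by
  simp only [val, map_list_prod, List.map_map, valM, MulOpposite.unop_list_prod, List.map_reverse]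
  rfl

theorem valM_append (u v : List ℕ) : valM n (u ++ v) = valM n u * valM n v := by simp [valM]

theorem valM_cons (a : ℕ) (v : List ℕ) : valM n (a :: v) = letter n a * valM n v := by simp [valM]

theorem Swap.valM_eq {u v : List ℕ} (h : Swap u v) : valM n u = valM n v := by
  rw [← toMRight_val, ← toMRight_val, h.val_eq]

/-- Absorption by a prefix is transported by `toMRight`. Absorption by a suffix is transported by
`toMLeft`, which exists because the two cubic relations of `M n` are mirror images. -/
theorem Kill.valM_eq {u v : List ℕ} (h : Kill u v) : valM n u = valM n v := by
  cases h with
  | right p c q h =>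
    rw [← toMRight_val, ← toMRight_val, val_append, val_cons, ← mul_assoc, h, val_append]
  | left p c q h =>
    rw [valM_append, valM_append, valM_cons]
    congr 1
    have := congrArg (fun y => (toMLeft n y).unop) h
    simp only [map_mul, MulOpposite.unop_mul, toMLeft_val, List.reverse_reverse] at this
    exact this

theorem valM_indices (w : Word n) : valM n (indices w) = toM w := by
  induction w using FreeMonoid.recOn with
  | one => simp [valM]
  | of_mul a w ih =>
    rw [indices_mul, valM_append, ih, map_mul]
    simp [valM, letter]

theorem valM_eq_of_eqvGen {u v : List ℕ} (h : Relation.EqvGen Swap u v) : valM n u = valM n v := by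
  induction h with
  | rel u v h => exact h.valM_eq
  | refl => rfl
  | symm _ _ _ ih => exact ih.symm
  | trans _ _ _ _ _ ih ih' => exact ih.trans ih'

end interpretation

/-! ### Reduced words are the normal words -/

section reduced

variable {n : ℕ}

theorem run_self (b : ℕ) : run n b b = 1 := by
  have : (List.finRange n).filter (fun i : Fin n => b ≤ (i : ℕ) ∧ (i : ℕ) < b) = [] := by
    simp only [List.filter_eq_nil_iff, decide_eq_true_eq]
    intros; omega
  rw [run, this]
  rfl

theorem run_succ {a b : ℕ} (hb : b ≤ a) (ha : a < n) :
    run n (a + 1) b = x ⟨a, ha⟩ * run n a b := by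
  have : (List.finRange n).filter (fun i : Fin n => b ≤ (i : ℕ) ∧ (i : ℕ) < a + 1) =
      (List.finRange n).filter (fun i : Fin n => b ≤ (i : ℕ) ∧ (i : ℕ) < a) ++ [⟨a, ha⟩] := by
    have h1 : (List.finRange n).Pairwise (· < ·) := List.pairwise_lt_finRange n
    have p1 := h1.filter (fun i : Fin n => decide (b ≤ (i : ℕ) ∧ (i : ℕ) < a + 1))
    have p2 := h1.filter (fun i : Fin n => decide (b ≤ (i : ℕ) ∧ (i : ℕ) < a))
    have p3 : ((List.finRange n).filter (fun i : Fin n => b ≤ (i : ℕ) ∧ (i : ℕ) < a) ++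
        [(⟨a, ha⟩ : Fin n)]).Pairwise (· < ·) := by
      rw [List.pairwise_append]
      refine ⟨p2, by simp, ?_⟩
      intro i hi j hj
      simp only [List.mem_filter, decide_eq_true_eq] at hi
      rw [List.mem_singleton.1 hj]
      exact Fin.lt_def.2 hi.2.2
    refine List.Pairwise.eq_of_mem_iff p1 p3 fun i => ?_
    simp [Fin.ext_iff]
    omega
  rw [run, this]
  simp [run, FreeMonoid.ofList_cons]

/-- The state of the automaton after reading a list whose head is the letter read last. -/
noncomputable def stackState (l : List (Fin n)) : State := state (l.map Fin.val).reverse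

@[simp] theorem stackState_nil (i j : ℕ) : ¬ stackState ([] : List (Fin n)) i j := id

theorem stackState_cons (e : Fin n) (l : List (Fin n)) :
    stackState (e :: l) = step (stackState l) e := by
  rw [stackState, List.map_cons, List.reverse_cons, state_snoc]
  rfl

/-- No letter of the stack is absorbed by the letters below it. -/
def Taut : List (Fin n) → Prop
  | [] => True
  | e :: l => ¬ stackState l e e ∧ Taut l

theorem Taut.stackState_cons {e : Fin n} {l : List (Fin n)} (h : Taut (e :: l)) :
    stackState (e :: l) = pull (stackState l) e := by
  rw [CIMonoid.stackState_cons, step_of_neg h.1]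

/-- The absorbed letter chosen is the first in reading order, so below it the automaton has kept
every letter and each transition is a `pull`. -/
theorem taut_or (l : List (Fin n)) :
    Taut l ∨ ∃ l₁ e l₂, l = l₁ ++ e :: l₂ ∧ stackState l₂ e e ∧ Taut l₂ := by
  induction l with
  | nil => exact Or.inl trivial
  | cons e l ih =>
    rcases ih with h | ⟨l₁, e', l₂, rfl, h⟩
    · by_cases he : stackState l e e
      · exact Or.inr ⟨[], e, l, rfl, he, h⟩
      · exact Or.inl ⟨he, h⟩
    · exact Or.inr ⟨e :: l₁, e', l₂, rfl, h⟩

theorem taut_iff {l : List (Fin n)} :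
    Taut l ↔ ∀ l₁ e l₂, l = l₁ ++ e :: l₂ → ¬ stackState l₂ e e := by
  induction l with
  | nil => simp [Taut]
  | cons e l ih =>
    rw [Taut, ih]
    constructor
    · rintro ⟨h, h'⟩ l₁ e' l₂ hl
      cases l₁ with
      | nil => simp only [List.nil_append, List.cons.injEq] at hl; rwa [← hl.1, ← hl.2]
      | cons a l₁ => simp only [List.cons_append, List.cons.injEq] at hl; exact h' _ _ _ hl.2
    · exact fun h => ⟨h [] e l rfl, fun l₁ e' l₂ hl => h (e :: l₁) e' l₂ (by rw [hl]; rfl)⟩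

theorem not_kill_of_taut {u : Word n} (h : Taut u.toList) (h' : Taut u.toList.reverse) :
    ¬ ∃ v, Kill (indices u) v := by
  rw [taut_iff] at h h'
  rintro ⟨v, hk⟩
  have split : ∀ p c q, p ++ c :: q = indices u →
      ∃ (p' : List (Fin n)) (c' : Fin n) (q' : List (Fin n)), u.toList = p' ++ c' :: q' ∧ p'.map Fin.val = p ∧ (c' : ℕ) = c ∧
        q'.map Fin.val = q := by
    intro p c q hu
    obtain ⟨p', r, h1, h2, h3⟩ := List.map_eq_append_iff.1 hu.symm
    obtain ⟨c', q', rfl, h4, h5⟩ := List.map_eq_cons_iff.1 h3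
    exact ⟨p', c', q', h1, h2, h4, h5⟩
  generalize hu : indices u = u' at hk
  cases hk with
  | right p c q hc =>
    obtain ⟨p', c', q', h1, rfl, rfl, rfl⟩ := split p c q hu.symm
    refine h' q'.reverse c' p'.reverse (by simp [h1]) ?_
    rwa [stackState, List.map_reverse, List.reverse_reverse, ← absorbs_iff]
  | left p c q hc =>
    obtain ⟨p', c', q', h1, rfl, rfl, rfl⟩ := split p c q hu.symm
    exact h p' c' q' h1 (by rwa [stackState, ← absorbs_iff])

/-- The descent condition for words that are read from right to left. -/
abbrev Rev (l : List (Fin n)) : Prop := l.IsChain fun a b : Fin n => (b : ℕ) ≤ a + 1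

/-- The descent condition for words that are read from left to right. -/
abbrev Fwd (l : List (Fin n)) : Prop := l.IsChain fun a b : Fin n => (a : ℕ) ≤ b + 1

/-- Going down the stack, indices rise by at most one. From an index at most `i - 2`, the letter
`x_i` is reached only through `x_{i-1}`, which destroys every pair `(k, i)` with `k < i`. -/
theorem Rev.not_stackState {f : Fin n} {l : List (Fin n)} {k i : ℕ} (hl : Rev (f :: l))
    (ht : Taut l) (hk : k < i) (hf : (f : ℕ) + 2 ≤ i) : ¬ stackState l k i := by
  induction l generalizing f k with
  | nil => simp
  | cons e l ih =>
    replace hl := List.isChain_cons_cons.1 hl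
    rw [ht.stackState_cons]
    rintro ⟨-, h⟩
    have he := hl.1
    rw [if_neg (by omega)] at h
    split_ifs at h with h'
    · exact ih hl.2 ht.2 (by omega) (by omega) h
    · exact ih hl.2 ht.2 hk (by omega) h.2

/-- This is why `x_i x_{i-1}` is contiguous in a ladder: any other letter between the two leads to
`Rev.not_stackState`. -/
theorem Rev.stackState_rung {f : Fin n} {l : List (Fin n)} {i : ℕ} (hl : Rev (f :: l))
    (ht : Taut l) (hf : (f : ℕ) + 1 = i) (h : stackState l f i) :
    ∃ e l', l = e :: l' ∧ (e : ℕ) = i ∧ stackState l' f f := by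
  cases l with
  | nil => simp at h
  | cons e l =>
    replace hl := List.isChain_cons_cons.1 hl
    rw [ht.stackState_cons] at h
    obtain ⟨-, h⟩ := h
    have he := hl.1
    split_ifs at h with h1 h2
    · refine ⟨e, l, rfl, h1, ?_⟩
      rwa [← hf, Nat.add_sub_cancel, or_iff_right (by omega)] at h
    · exact absurd h (Rev.not_stackState hl.2 ht.2 (by omega) (by omega))
    · exact absurd h.2 (Rev.not_stackState hl.2 ht.2 (by omega) (by omega))

theorem ofList_mem_closure {s : Set (Fin n)} {l : List (Fin n)} (h : ∀ i ∈ l, i ∈ s) :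
    (FreeMonoid.ofList l : Word n) ∈ Submonoid.closure (FreeMonoid.of '' s) := by
  induction l with
  | nil => exact one_mem _
  | cons a l ih =>
    rw [FreeMonoid.ofList_cons]
    exact mul_mem (Submonoid.subset_closure ⟨a, h a (by simp), rfl⟩) (ih fun i hi => h i (by simp [hi]))

/-- A small letter joins the last word `z`. The one-letter ladder has no `z`, but in a descent-free
word that letter cannot be followed by a smaller far one. -/
theorem Ladder.append {a b e : Fin n} {w : Word n} (h : Ladder a b w) (he : (e : ℕ) + 1 < b) :
    (∃ p, w = p * x b ∧ a = b) ∨ Ladder a b (w * x e) := by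
  cases h with
  | base => exact Or.inl ⟨1, by simp, rfl⟩
  | @step b _ w y z hw hc hy hz =>
    right
    rw [mul_assoc, mul_assoc _ z]
    refine .step hw hc hy (mul_mem hz (Submonoid.subset_closure ⟨e, ?_, rfl⟩))
    simp only [Set.mem_ofPred_eq, Fin.lt_def]
    omega

/-- The pair `(i, i)` comes from reading `x_i`, from a rung, or from a far letter read after it. A
rung prolongs the ladder for `i - 1`; letters above `i + 1` are gathered in `y`, the start of the
next block; letters below `i - 1` go into the last `z`. -/
theorem Rev.exists_ladder {l : List (Fin n)} {i : Fin n} (hl : Rev l) (ht : Taut l)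
    (h : stackState l i i) :
    ∃ (a : Fin n) (p w : Word n) (y : List (Fin n)), Ladder a i w ∧
      (∀ j ∈ y, (i : ℕ) + 1 < j) ∧ FreeMonoid.ofList l.reverse = p * w * FreeMonoid.ofList y := by
  induction hk : l.length using Nat.strong_induction_on generalizing l i with
  | _ k ih =>
  subst hk
  cases l with
  | nil => simp at h
  | cons e l =>
    rw [ht.stackState_cons] at h
    obtain ⟨-, h⟩ := h
    split_ifs at h with h1 h2
    · obtain rfl : e = i := Fin.ext h1
      exact ⟨e, FreeMonoid.ofList l.reverse, x e, [], .base, by simp, by simp⟩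
    · obtain ⟨e', l', rfl, he', hl'⟩ := Rev.stackState_rung hl ht.2 h2 h
      obtain rfl : e' = i := Fin.ext he'
      obtain ⟨a, p, w, y, hw, hy, hp⟩ := ih l'.length (by simp)
        (l := l') (i := e) (List.isChain_cons.1 (List.isChain_cons.1 hl).2).2 ht.2.2 hl' rfl
      refine ⟨a, p, _, [], hw.step h2.symm (ofList_mem_closure (l := y) fun j hj => ?_)
        (one_mem _), by simp, ?_⟩
      · have := hy j hj
        simp only [Set.mem_ofPred_eq, Fin.lt_def]
        omega
      · simp only [List.reverse_cons, List.append_assoc, FreeMonoid.ofList_append, hp]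
        simp [mul_assoc]
    · obtain ⟨a, p, w, y, hw, hy, hp⟩ := ih l.length (by simp) (List.isChain_cons.1 hl).2 ht.2
        h.2 rfl
      rcases h.1 with h1 | h1
      -- A letter below `i - 1` directly after one above `i + 1` would be a descent.
      · obtain rfl : y = [] := by
          rcases List.eq_nil_or_concat y with rfl | ⟨y, j, rfl⟩
          · rfl
          · have hj := hy j (by simp)
            have := congrArg FreeMonoid.toList hp
            simp only [FreeMonoid.toList_ofList, FreeMonoid.toList_mul] at this
            have := congrArg List.reverse this
            simp only [List.reverse_reverse, List.reverse_append, List.concat_eq_append,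
              List.reverse_cons, List.reverse_nil, List.nil_append, List.cons_append] at this
            rw [this, Rev, List.isChain_cons_cons] at hl
            have := hl.1
            omega
        rcases hw.append h1 with ⟨p', rfl, -⟩ | hw'
        · have := congrArg FreeMonoid.toList hp
          simp only [FreeMonoid.toList_ofList, FreeMonoid.toList_mul] at this
          have := congrArg List.reverse this
          simp only [List.reverse_reverse, List.reverse_append, FreeMonoid.toList_of,
            List.reverse_cons, List.reverse_nil, List.nil_append, List.cons_append] at this
          rw [this, Rev, List.isChain_cons_cons] at hl
          have := hl.1
          omega
        · refine ⟨a, p, _, [], hw', by simp, ?_⟩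
          rw [List.reverse_cons, FreeMonoid.ofList_append, hp]
          simp [mul_assoc]
      · refine ⟨a, p, w, y ++ [e], hw, ?_, ?_⟩
        · intro j hj
          rcases List.mem_append.1 hj with hj | hj
          · exact hy j hj
          · simp only [List.mem_singleton] at hj
            rwa [hj]
        · rw [List.reverse_cons, FreeMonoid.ofList_append, hp, FreeMonoid.ofList_append, mul_assoc]

/-- Here indices fall by at most one down the stack, so from `i + 2` or above the letters up to `i`
are reached only through `x_{i+1}`, which destroys all pairs ending in `i`. -/
theorem Fwd.not_stackState {f : Fin n} {l : List (Fin n)} {k i : ℕ} (hl : Fwd (f :: l))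
    (ht : Taut l) (hf : i + 2 ≤ f) : ¬ stackState l k i := by
  induction l generalizing f with
  | nil => simp
  | cons e l ih =>
    replace hl := List.isChain_cons_cons.1 hl
    rw [ht.stackState_cons]
    rintro ⟨hk, h⟩
    have he := hl.1
    rw [if_neg (by omega), if_neg (by omega)] at h
    exact ih hl.2 ht.2 (by omega) h.2

/-- Next to `x_{i+1}` only `x_i` is compatible with the pair `(k, i)`, which then comes from `(k, i
- 1)` unless `k = i`; so the run unwinds down to `x_k`. -/
theorem Fwd.eq_run {f : Fin n} {l : List (Fin n)} {k i : ℕ} (hl : Fwd (f :: l))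
    (ht : Taut l) (hf : (f : ℕ) = i + 1) (hi : i < n) (h : stackState l k i) :
    k ≤ i ∧ ∃ q : Word n, FreeMonoid.ofList l = run n (i + 1) k * q := by
  induction l generalizing f i with
  | nil => simp at h
  | cons e l ih =>
    replace hl := List.isChain_cons_cons.1 hl
    rw [ht.stackState_cons] at h
    obtain ⟨hk, h⟩ := h
    refine ⟨hk, ?_⟩
    have he := hl.1
    split_ifs at h with h1 h2
    · obtain rfl : e = ⟨i, hi⟩ := Fin.ext h1
      rw [run_succ hk hi, FreeMonoid.ofList_cons]
      rcases h with rfl | h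
      · exact ⟨FreeMonoid.ofList l, by simp [run_self]⟩
      · rcases Nat.eq_zero_or_pos i with rfl | hpos
        · obtain rfl : k = 0 := by omega
          exact ⟨FreeMonoid.ofList l, by simp [run_self]⟩
        · obtain ⟨j, rfl⟩ : ∃ j, i = j + 1 := ⟨i - 1, by omega⟩
          obtain ⟨-, q, hq⟩ := ih hl.2 ht.2 (i := j) rfl (by omega) h
          exact ⟨q, by rw [hq, mul_assoc]⟩
    · omega
    · exact absurd h.2 (Fwd.not_stackState hl.2 ht.2 (by omega))

/-- The rungs `x_{f-1}, x_{f-2}, …, x_m` must be consecutive, followed by the run that created the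
pair `(m, i)`. For `f = i`, putting `x_f` in front gives the left side of rule (b). -/
theorem Fwd.eq_run_mul_run {f : Fin n} {l : List (Fin n)} {i : ℕ} (hl : Fwd (f :: l))
    (ht : Taut l) (hi : i < n) (hf : (f : ℕ) ≤ i) (h : stackState l f i) :
    ∃ (m : ℕ) (q : Word n), m ≤ f ∧
      FreeMonoid.ofList l = run n f m * run n (i + 1) m * q := by
  induction l generalizing f with
  | nil => simp at h
  | cons e l ih =>
    replace hl := List.isChain_cons_cons.1 hl
    rw [ht.stackState_cons] at h
    obtain ⟨hk, h⟩ := h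
    have he := hl.1
    split_ifs at h with h1 h2
    · obtain rfl : e = ⟨i, hi⟩ := Fin.ext h1
      refine ⟨f, ?_⟩
      rw [run_succ hf hi, FreeMonoid.ofList_cons, run_self]
      rcases h with h | h
      · exact ⟨FreeMonoid.ofList l, le_rfl, by simp [h, run_self]⟩
      · rcases Nat.eq_zero_or_pos i with rfl | hpos
        · exact ⟨FreeMonoid.ofList l, le_rfl, by simp [show (f : ℕ) = 0 by omega, run_self]⟩
        · obtain ⟨j, rfl⟩ : ∃ j, i = j + 1 := ⟨i - 1, by omega⟩
          obtain ⟨-, q, hq⟩ := Fwd.eq_run hl.2 ht.2 (i := j) rfl (by omega) h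
          exact ⟨q, le_rfl, by rw [hq]; simp [mul_assoc]⟩
    · obtain ⟨m, q, hm, hq⟩ := ih hl.2 ht.2 (by omega) h
      refine ⟨m, q, by omega, ?_⟩
      rw [FreeMonoid.ofList_cons, hq, ← h2, run_succ hm e.2]
      simp [mul_assoc]
    · exact absurd h.2 (Fwd.not_stackState hl.2 ht.2 (by omega))

theorem toList_eq {u : Word n} {l : List (Fin n)} (h : u.toList = l) : u = FreeMonoid.ofList l :=
  h

theorem IsReduced.fwd {u : Word n} (h : IsReduced u) : Fwd u.toList := by
  rw [Fwd, List.isChain_iff_forall_rel_of_append_cons_cons]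
  intro a b l₁ l₂ hu
  by_contra hab
  have hu' : u = FreeMonoid.ofList l₁ * (x a * x b) * FreeMonoid.ofList l₂ := by
    rw [toList_eq hu]
    simp [FreeMonoid.ofList_append, FreeMonoid.ofList_cons, mul_assoc]
  rw [hu'] at h
  exact h ⟨_, .mk _ _ _ _ (.comm a b (by omega))⟩

/-- The first absorbed letter read from the right exhibits rule (b), and the first one read from the
left exhibits rule (c). -/
theorem IsReduced.normal {u : Word n} (h : IsReduced u) : Normal (indices u) := by
  have hf := h.fwd
  refine ⟨not_kill_of_taut ?_ ?_, by rwa [DescentFree, indices, List.isChain_map]⟩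
  · refine (taut_or _).resolve_right ?_
    rintro ⟨l₁, e, l₂, hu, hs, ht⟩
    have hc : Fwd (e :: l₂) := by
      rw [hu, Fwd, List.isChain_append] at hf
      exact hf.2.1
    obtain ⟨m, q, hm, hq⟩ := Fwd.eq_run_mul_run hc ht e.2 le_rfl hs
    have hu' : u = FreeMonoid.ofList l₁ * (run n (e + 1) m * run n (e + 1) m) * q := by
      rw [toList_eq hu, FreeMonoid.ofList_append, FreeMonoid.ofList_cons, hq]
      nth_rw 2 [run_succ hm e.2]
      simp only [mul_assoc]
    rw [hu'] at h
    exact h ⟨_, .mk _ _ _ _ (.double e m hm e.2)⟩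
  · refine (taut_or _).resolve_right ?_
    rintro ⟨l₁, e, l₂, hu, hs, ht⟩
    have hf' : Rev u.toList.reverse := by rwa [Rev, List.isChain_reverse]
    have hc : Rev (e :: l₂) := by
      rw [hu, Rev, List.isChain_append] at hf'
      exact hf'.2.1
    obtain ⟨a, p, w, y, hw, hy, hp⟩ := Rev.exists_ladder (List.isChain_cons.1 hc).2 ht hs
    -- A last letter of `y` would exceed `e + 1` and stand directly before `e`, a descent.
    obtain rfl : y = [] := by
      rcases List.eq_nil_or_concat y with rfl | ⟨y, j, rfl⟩
      · rfl
      · have hj := hy j (by simp)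
        have := congrArg FreeMonoid.toList hp
        simp only [FreeMonoid.toList_ofList, FreeMonoid.toList_mul] at this
        have := congrArg List.reverse this
        simp only [List.reverse_reverse, List.reverse_append, List.concat_eq_append,
          List.reverse_cons, List.reverse_nil, List.nil_append, List.cons_append] at this
        rw [this, Rev, List.isChain_cons_cons] at hc
        have := hc.1
        omega
    refine h ⟨p * w * FreeMonoid.ofList l₁.reverse, ?_⟩
    have hu' : u = p * (w * x e) * FreeMonoid.ofList l₁.reverse := by
      have := congrArg List.reverse hu
      rw [List.reverse_reverse] at this
      rw [toList_eq this]
      simp only [List.reverse_append, List.reverse_cons, FreeMonoid.ofList_append, hp]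
      simp [mul_assoc]
    rw [hu']
    exact .mk _ _ _ _ (.ladder a e w hw)

theorem Claim.far_word {y : RightMonoid} {k i : ℕ} (h : Claim y k i) {w : Word n}
    {s : Set (Fin n)} (hw : w ∈ Submonoid.closure (FreeMonoid.of '' s))
    (hs : ∀ e ∈ s, (e : ℕ) + 1 < k ∨ i + 1 < e) : Claim (y * val (indices w)) k i := by
  induction hw using Submonoid.closure_induction generalizing y with
  | mem w hw =>
    obtain ⟨e, he, rfl⟩ := hw
    simpa using h.far (hs e he)
  | one => simpa using h
  | mul u v _ _ hu hv =>
    rw [indices_mul, val_append, ← mul_assoc]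
    exact hv (hu h)

/-- Each block turns `(b, b)` into `(b, b + 1)` and then into `(b + 1, b + 1)`, while the letters of
`y` and `z` are far enough to preserve the current pair. -/
theorem Ladder.claim {a b : Fin n} {w : Word n} (h : Ladder a b w) (y : RightMonoid) :
    Claim (y * val (indices w)) b b := by
  induction h with
  | base => exact .base (by simp [mul_assoc, gen_idem])
  | @step b c w v z hw hc hv hz ih =>
    have h1 := ih.far_word hv fun e he => Or.inr (by
      simp only [Set.mem_ofPred_eq, Fin.lt_def] at he; omega)
    have h2 := h1.snoc.rung (by omega)
    rw [← hc] at h2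
    have h3 := h2.far_word hz fun e he => Or.inl (by
      simp only [Set.mem_ofPred_eq, Fin.lt_def] at he; omega)
    simpa [mul_assoc] using h3

theorem claim_run {y : RightMonoid} {a b : ℕ} (hb : b ≤ a) (ha : a < n) :
    Claim (y * val (indices (run n (a + 1) b)).reverse) b a := by
  induction a, hb using Nat.le_induction with
  | base =>
    rw [run_succ le_rfl ha, run_self]
    exact .base (by simp [mul_assoc, gen_idem])
  | succ a hb ih =>
    rw [run_succ (by omega) ha]
    simpa [mul_assoc] using (ih (by omega)).snoc

theorem Claim.run {y : RightMonoid} {a b i : ℕ} (h : Claim y b i) (hb : b ≤ a) (ha : a ≤ i)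
    (hi : i < n) : Claim (y * val (indices (run n a b)).reverse) a i := by
  induction a, hb using Nat.le_induction with
  | base => simpa [run_self] using h
  | succ a hb ih =>
    rw [run_succ (by omega) (by omega)]
    simpa [mul_assoc] using (ih (by omega)).rung ha

/-- Rule (a) needs a descent. Rule (b) deletes the first letter of the doubled run: read from the
right, the second run creates the pair `(b, a)` and the letters of the first lift it to `(a, a)`.
Rule (c) deletes a letter absorbed by its ladder. -/
theorem Normal.isReduced {u : Word n} (h : Normal (indices u)) : IsReduced u := by
  rintro ⟨v, hv⟩
  cases hv with
  | mk p u v q hr =>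
    cases hr with
    | comm a b hab =>
      have := h.2
      simp only [indices_mul, indices_x, List.append_assoc, List.cons_append, List.nil_append,
        DescentFree, List.isChain_append, List.isChain_cons_cons] at this
      omega
    | double a b hb ha =>
      refine h.1 ?_
      have hc := ((claim_run (y := val (indices q).reverse) hb ha).run hb le_rfl ha).absorb
      rw [show run n (a + 1) b * run n (a + 1) b =
        x ⟨a, ha⟩ * (run n a b * run n (a + 1) b) by rw [run_succ hb ha, mul_assoc]]
      have := Kill.left (indices p) a (indices (run n a b) ++ indices (run n (a + 1) b) ++ indices q)
        (by simpa [Absorbs, mul_assoc] using hc)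
      exact ⟨_, by simpa using this⟩
    | ladder a b w hw =>
      refine h.1 ?_
      have hc := (hw.claim (val (indices p))).absorb
      have := Kill.right (indices p ++ indices v) b (indices q)
        (by simpa [Absorbs] using hc)
      exact ⟨_, by simpa using this⟩

theorem Normal.word_eq {u v : Word n} (hu : Normal (indices u)) (hv : Normal (indices v))
    (h : toM u = toM v) : u = v :=
  indices_injective (hu.eq hv (traceNF_eq_of_con (toM_eq_iff.1 h)))

end reduced

/-! ### The normalization algorithm on lists -/

/-- The data of the normalization algorithm: an automaton that reads words over `Γ` and may drop
letters, and a test that tells whether a letter has to be moved below another one. -/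
structure Scanner (Γ S : Type) where
  /-- the initial state of the automaton -/
  init : S
  /-- the transition for letters that are kept -/
  next : S → Γ → S
  /-- whether a letter is dropped -/
  drop : S → Γ → Bool
  /-- whether the second letter is inserted below the first -/
  jump : Γ → Γ → Bool

namespace Scanner

variable {Γ S : Type} (P : Scanner Γ S)

/-- Reads a word and collects the letters that are kept on a stack. -/
def scan : S → List Γ → List Γ → List Γ
  | _, [], acc => acc
  | s, c :: l, acc => if P.drop s c then scan s l acc else scan (P.next s c) l (c :: acc)

/-- The state after reading a word. -/
def final : S → List Γ → S
  | s, [] => s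
  | s, c :: l => if P.drop s c then final s l else final (P.next s c) l

/-- Deletes absorbed letters and reverses the word. -/
def pass (l : List Γ) : List Γ := P.scan P.init l []

theorem scan_eq (s : S) (l acc : List Γ) : P.scan s l acc = P.scan s l [] ++ acc := by
  induction l generalizing s acc with
  | nil => simp [scan]
  | cons c l ih =>
    rw [scan, scan]
    split_ifs
    · exact ih _ _
    · rw [ih, ih _ [c]]; simp

theorem scan_append (s : S) (l r acc : List Γ) :
    P.scan s (l ++ r) acc = P.scan (P.final s l) r (P.scan s l acc) := by
  induction l generalizing s acc with
  | nil => rfl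
  | cons c l ih =>
    rw [List.cons_append, scan, scan, final]
    split_ifs <;> exact ih _ _

theorem length_scan_le (s : S) (l acc : List Γ) :
    (P.scan s l acc).length ≤ l.length + acc.length := by
  induction l generalizing s acc with
  | nil => simp [scan]
  | cons c l ih =>
    rw [scan]
    split_ifs
    · have := ih s acc; simp; omega
    · have := ih (P.next s c) (c :: acc); simp at this ⊢; omega

theorem length_pass_le (l : List Γ) : (P.pass l).length ≤ l.length :=
  P.length_scan_le _ l []

/-- Deletion of absorbed letters, normalizing until nothing changes. -/
def norm (l : List Γ) : List Γ :=
  if (P.pass (P.pass l)).length < l.length then norm (P.pass (P.pass l)) else P.pass (P.pass l)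
termination_by l.length

theorem scan_of_length (s : S) (l acc : List Γ)
    (h : l.length + acc.length ≤ (P.scan s l acc).length) : P.scan s l acc = l.reverse ++ acc := by
  induction l generalizing s acc with
  | nil => rfl
  | cons c l ih =>
    rw [scan] at h ⊢
    split_ifs at h ⊢
    · have := P.length_scan_le s l acc
      simp at h; omega
    · rw [ih _ _ (by simp at h ⊢; omega)]; simp

theorem pass_of_length {l : List Γ} (h : l.length ≤ (P.pass l).length) : P.pass l = l.reverse := by
  simpa [pass] using P.scan_of_length _ l [] (by simpa [pass] using h)

/-- The fixed-point property shows that no letter of the result can be deleted, and it makes the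
result independent of the number of rounds. -/
theorem exists_norm_eq (l : List Γ) :
    ∃ k, P.norm l = (fun l => P.pass (P.pass l))^[k] l ∧ P.pass (P.pass (P.norm l)) = P.norm l := by
  induction h : l.length using Nat.strong_induction_on generalizing l with
  | _ m ih =>
  rw [norm]
  split_ifs with hl
  · obtain ⟨k, hk, hf⟩ := ih _ (h ▸ hl) _ rfl
    exact ⟨k + 1, hk, hf⟩
  · have h1 := P.length_pass_le l
    have h2 := P.length_pass_le (P.pass l)
    have e1 := P.pass_of_length (l := l) (by omega)
    have e2 := P.pass_of_length (l := P.pass l) (by omega)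
    have e : P.pass (P.pass l) = l := by rw [e2, e1, List.reverse_reverse]
    exact ⟨1, rfl, by rw [e, e]⟩

theorem length_norm_le (l : List Γ) : (P.norm l).length ≤ l.length := by
  induction h : l.length using Nat.strong_induction_on generalizing l with
  | _ m ih =>
  have h1 := P.length_pass_le l
  have h2 := P.length_pass_le (P.pass l)
  rw [norm]
  split_ifs with hl
  · have := ih _ (h ▸ hl) _ rfl
    omega
  · omega

/-- Insertion of a letter into a stack. -/
def insert : List Γ → Γ → List Γ
  | [], c => [c]
  | t :: u, c => if P.jump t c then t :: insert u c else c :: t :: u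

theorem length_insert (u : List Γ) (c : Γ) : (P.insert u c).length = u.length + 1 := by
  induction u with
  | nil => rfl
  | cons t u ih => rw [insert]; split_ifs <;> simp [ih]

/-- Insertion sort, with the last letter on top of the resulting stack. -/
def sort (l : List Γ) : List Γ := l.foldl P.insert []

theorem length_sort (l : List Γ) : (P.sort l).length = l.length := by
  have key : ∀ u, (l.foldl P.insert u).length = u.length + l.length := by
    induction l with
    | nil => simp
    | cons c l ih => intro u; rw [List.foldl_cons, ih, length_insert]; simp; omega
  simpa [sort] using key []

end Scanner

/-! ### Correctness of the algorithm for the CI monoid -/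

variable {n : ℕ}

/-- The states of the automaton over `n` letters. -/
abbrev BoundedState (n : ℕ) : Type := {s : State // ∀ l i, s l i → l < n ∧ i < n}

noncomputable instance : Fintype (BoundedState n) := by
  refine @Fintype.ofFinite _ (Finite.of_injective
    (fun s : BoundedState n => fun l i : Fin n => s.1 l i) fun s t h => ?_)
  refine Subtype.ext (funext fun l => funext fun i => propext ⟨fun hs => ?_, fun ht => ?_⟩)
  · obtain ⟨hl, hi⟩ := s.2 l i hs
    exact (congrFun (congrFun h ⟨l, hl⟩) ⟨i, hi⟩).mp hs
  · obtain ⟨hl, hi⟩ := t.2 l i ht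
    exact (congrFun (congrFun h ⟨l, hl⟩) ⟨i, hi⟩).mpr ht

theorem step_bounded (s : BoundedState n) (e : Fin n) :
    ∀ l i, step s.1 e l i → l < n ∧ i < n := by
  intro l i h
  have := e.2
  by_cases he : s.1 e e
  · rw [step_of_pos he] at h
    exact s.2 l i h
  · rw [step_of_neg he] at h
    obtain ⟨hl, h⟩ := h
    split_ifs at h with h1 h2
    · omega
    · have := s.2 _ _ h
      omega
    · exact s.2 l i h.2

open Classical in
/-- The scanner for words over an alphabet whose symbols are letters or separators. -/
noncomputable def scanner {Γ : Type} (g : Γ → Option (Fin n)) : Scanner Γ (BoundedState n) where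
  init := ⟨fun _ _ => False, by simp⟩
  next s c := match g c with
    | none => ⟨fun _ _ => False, by simp⟩
    | some i => ⟨step s.1 i, step_bounded s i⟩
  drop s c := match g c with
    | none => false
    | some i => decide (s.1 i i)
  jump t c := match g t, g c with
    | some i, some j => decide ((j : ℕ) + 2 ≤ i)
    | _, _ => false

/-- The scanner for words without separators. -/
noncomputable abbrev wordScanner (n : ℕ) : Scanner (Fin n) (BoundedState n) := scanner some

/-- The scanner for words with separators. -/
noncomputable abbrev pairScanner (n : ℕ) : Scanner (Option (Fin n)) (BoundedState n) := scanner id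

theorem drop_iff {s : BoundedState n} {c : Fin n} :
    (wordScanner n).drop s c = true ↔ s.1 c c := by
  simp [scanner]

theorem reflTransGen_scan (l acc : List (Fin n)) (s : BoundedState n) (hs : s.1 = stackState acc) :
    Relation.ReflTransGen Kill ((acc.reverse ++ l).map Fin.val)
      (((wordScanner n).scan s l acc).reverse.map Fin.val) := by
  induction l generalizing s acc with
  | nil => simp [Scanner.scan, Relation.ReflTransGen.refl]
  | cons c l ih =>
    rw [Scanner.scan]
    split_ifs with h
    · refine .head ?_ (ih _ _ hs)
      have := Kill.right (acc.reverse.map Fin.val) c (l.map Fin.val) (by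
        rw [absorbs_iff, List.map_reverse]
        rw [drop_iff, hs] at h
        exact h)
      simpa using this
    · have := ih (c :: acc) ((wordScanner n).next s c) (by rw [stackState_cons, ← hs]; rfl)
      simpa using this

theorem reflTransGen_pass (l : List (Fin n)) :
    Relation.ReflTransGen Kill (l.map Fin.val) (((wordScanner n).pass l).reverse.map Fin.val) := by
  simpa [Scanner.pass] using reflTransGen_scan l [] (wordScanner n).init rfl

theorem reflTransGen_pass_pass (l : List (Fin n)) :
    Relation.ReflTransGen Kill (l.map Fin.val)
      (((wordScanner n).pass ((wordScanner n).pass l)).map Fin.val) := by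
  refine (reflTransGen_pass l).trans ?_
  have := (reflTransGen_pass ((wordScanner n).pass l)).lift List.reverse
    (fun a b h => Kill.reverse h)
  simpa [Function.onFun] using this

theorem reflTransGen_norm (l : List (Fin n)) :
    Relation.ReflTransGen Kill (l.map Fin.val) (((wordScanner n).norm l).map Fin.val) := by
  obtain ⟨k, hk, -⟩ := (wordScanner n).exists_norm_eq l
  rw [hk]
  clear hk
  induction k generalizing l with
  | zero => exact .refl
  | succ k ih => exact (reflTransGen_pass_pass l).trans (ih _)

theorem taut_of_scan (l acc : List (Fin n)) (s : BoundedState n) (hs : s.1 = stackState acc)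
    (ht : Taut acc) (h : l.length + acc.length ≤ ((wordScanner n).scan s l acc).length) :
    Taut (l.reverse ++ acc) := by
  induction l generalizing s acc with
  | nil => exact ht
  | cons c l ih =>
    rw [Scanner.scan] at h
    split_ifs at h with hd
    · have := (wordScanner n).length_scan_le s l acc
      simp at h; omega
    · have := ih (c :: acc) ((wordScanner n).next s c) (by rw [stackState_cons, ← hs]; rfl)
        ⟨by rwa [drop_iff, hs] at hd, ht⟩ (by simp at h ⊢; omega)
      simpa using this

theorem taut_of_pass {l : List (Fin n)} (h : l.length ≤ ((wordScanner n).pass l).length) :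
    Taut l.reverse := by
  simpa using taut_of_scan l [] (wordScanner n).init rfl trivial (by simpa [Scanner.pass] using h)

/-- Passes never lengthen a word and two of them fix this one, so neither drops a letter: the first
excludes absorption by prefixes, the second by suffixes. -/
theorem not_kill_norm (l : List (Fin n)) :
    ¬ ∃ v, Kill (((wordScanner n).norm l).map Fin.val) v := by
  obtain ⟨-, -, h⟩ := (wordScanner n).exists_norm_eq l
  set w := (wordScanner n).norm l
  have h1 := (wordScanner n).length_pass_le w
  have h2 := (wordScanner n).length_pass_le ((wordScanner n).pass w)
  rw [h] at h2
  have e := (wordScanner n).pass_of_length h2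
  refine not_kill_of_taut (u := FreeMonoid.ofList w) ?_ (taut_of_pass h2)
  have := taut_of_pass (l := (wordScanner n).pass w) (by rw [h]; exact h1)
  rwa [e, List.reverse_reverse] at this

theorem map_sort (l : List (Fin n)) :
    ((wordScanner n).sort l).map Fin.val = sortStack (l.map Fin.val) := by
  have ins : ∀ (u : List (Fin n)) (c : Fin n),
      ((wordScanner n).insert u c).map Fin.val = insertLetter (u.map Fin.val) c := by
    intro u c
    induction u with
    | nil => rfl
    | cons t u ih =>
      rw [Scanner.insert, List.map_cons, insertLetter, ← ih]
      simp only [scanner, decide_eq_true_eq]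
      split_ifs <;> rfl
  have key : ∀ (l u : List (Fin n)), (l.foldl (wordScanner n).insert u).map Fin.val =
      (l.map Fin.val).foldl insertLetter (u.map Fin.val) := by
    intro l
    induction l with
    | nil => intro u; rfl
    | cons c l ih => intro u; rw [List.foldl_cons, ih, ins]; rfl
  exact key l []

/-- The `M`-reduced form of a word. -/
noncomputable def reducedForm (w : Word n) : Word n :=
  FreeMonoid.ofList ((wordScanner n).sort ((wordScanner n).norm w.toList)).reverse

theorem indices_reducedForm (w : Word n) : indices (reducedForm w) =
    (sortStack (((wordScanner n).norm w.toList).map Fin.val)).reverse := by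
  rw [indices, reducedForm, FreeMonoid.toList_ofList, List.map_reverse, map_sort]

theorem normal_reducedForm (w : Word n) : Normal (indices (reducedForm w)) := by
  rw [indices_reducedForm]
  exact normal_sortStack (not_kill_norm _)

theorem toM_reducedForm (w : Word n) : toM (reducedForm w) = toM w := by
  rw [← valM_indices, ← valM_indices w, indices_reducedForm,
    ← valM_eq_of_eqvGen (eqvGen_sortStack _)]
  have h := reflTransGen_norm w.toList
  change Relation.ReflTransGen Kill (indices w) _ at h
  generalize ((wordScanner n).norm w.toList).map Fin.val = w' at h
  induction h with
  | refl => rfl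
  | tail _ h ih => rw [← h.valM_eq, ih]

theorem isReducedForm_iff {u w : Word n} : IsReducedForm u w ↔ u = reducedForm w := by
  constructor
  · rintro ⟨hu, h⟩
    exact Normal.word_eq hu.normal (normal_reducedForm w)
      ((toM_eq_iff.2 h).trans (toM_reducedForm w).symm)
  · rintro rfl
    exact ⟨(normal_reducedForm w).isReduced, toM_eq_iff.1 (toM_reducedForm w)⟩

theorem reducedForm_eq_iff {u v : Word n} : reducedForm u = reducedForm v ↔ toM u = toM v := by
  constructor
  · intro h
    rw [← toM_reducedForm u, h, toM_reducedForm]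
  · intro h
    refine Normal.word_eq (normal_reducedForm u) (normal_reducedForm v) ?_
    rw [toM_reducedForm, h, toM_reducedForm]

/-! ### Normalizing a pair of words at once -/

/-- Two words, separated by `none`. -/
def joinPair (u v : List (Fin n)) : List (Option (Fin n)) := u.map some ++ none :: v.map some

theorem joinPair_inj {u v u' v' : List (Fin n)} (h : joinPair u v = joinPair u' v') :
    u = u' ∧ v = v' := by
  have := (List.append_cons_inj_of_notMem (by simp) (by simp)).1 h
  exact ⟨List.map_injective_iff.2 (Option.some_injective _) this.1,
    List.map_injective_iff.2 (Option.some_injective _) this.2.2⟩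

theorem scan_map_some (s : BoundedState n) (l acc : List (Fin n)) :
    (pairScanner n).scan s (l.map some) (acc.map some) =
      ((wordScanner n).scan s l acc).map some := by
  induction l generalizing s acc with
  | nil => rfl
  | cons c l ih =>
    rw [List.map_cons, Scanner.scan, Scanner.scan]
    have h1 : (pairScanner n).drop s (some c) = (wordScanner n).drop s c := rfl
    have h2 : (pairScanner n).next s (some c) = (wordScanner n).next s c := rfl
    rw [h1, h2]
    split_ifs
    · exact ih _ _
    · exact ih _ (c :: acc)

/-- A separator is kept and resets the automaton, so the words do not interact; a pass reverses
their order. -/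
theorem pass_joinPair (u v : List (Fin n)) : (pairScanner n).pass (joinPair u v) =
    joinPair ((wordScanner n).pass v) ((wordScanner n).pass u) := by
  rw [Scanner.pass, joinPair, Scanner.scan_append, Scanner.scan, if_neg (by simp [scanner]),
    Scanner.scan_eq]
  have h1 := scan_map_some (wordScanner n).init u []
  have h2 := scan_map_some (wordScanner n).init v []
  exact congrArg₂ (fun a b => a ++ none :: b) h2 h1

theorem eq_of_iterate_fixed {α : Type*} (f : α → α) {a : α} {k j : ℕ}
    (hk : f (f^[k] a) = f^[k] a) (hj : f (f^[j] a) = f^[j] a) : f^[k] a = f^[j] a := by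
  have key : ∀ k j, k ≤ j → f (f^[k] a) = f^[k] a → f^[k] a = f^[j] a := by
    intro k j h hk
    obtain ⟨i, rfl⟩ := Nat.exists_eq_add_of_le' h
    rw [Function.iterate_add_apply, Function.iterate_fixed hk]
  rcases le_total k j with h | h
  · exact key k j h hk
  · exact (key j k h hj).symm

/-- The pair may be iterated longer than either word alone, but all these iterations stop at fixed
points, and an orbit has only one. -/
theorem norm_joinPair (u v : List (Fin n)) : (pairScanner n).norm (joinPair u v) =
    joinPair ((wordScanner n).norm u) ((wordScanner n).norm v) := by
  have iter : ∀ (k : ℕ) (u v : List (Fin n)),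
      (fun l => (pairScanner n).pass ((pairScanner n).pass l))^[k] (joinPair u v) =
        joinPair ((fun l => (wordScanner n).pass ((wordScanner n).pass l))^[k] u)
          ((fun l => (wordScanner n).pass ((wordScanner n).pass l))^[k] v) := by
    intro k
    induction k with
    | zero => intro u v; rfl
    | succ k ih =>
      intro u v
      simp only [Function.iterate_succ_apply, pass_joinPair, ih]
  obtain ⟨k, hk, hf⟩ := (pairScanner n).exists_norm_eq (joinPair u v)
  obtain ⟨i, hi, hu⟩ := (wordScanner n).exists_norm_eq u
  obtain ⟨j, hj, hv⟩ := (wordScanner n).exists_norm_eq v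
  rw [hk, iter] at hf ⊢
  rw [pass_joinPair, pass_joinPair] at hf
  obtain ⟨h1, h2⟩ := joinPair_inj hf
  rw [hi] at hu ⊢
  rw [hj] at hv ⊢
  exact congrArg₂ joinPair (eq_of_iterate_fixed (a := u) _ h1 hu)
    (eq_of_iterate_fixed (a := v) _ h2 hv)

/-- No insertion passes a separator, so each word is sorted on its own. The second one ends on top
of the stack, whence the exchanged order. In the proof, `r` is what lies below: nothing, or a part
beginning with the separator. -/
theorem sort_joinPair (u v : List (Fin n)) : (pairScanner n).sort (joinPair u v) =
    joinPair ((wordScanner n).sort v) ((wordScanner n).sort u) := by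
  have ins : ∀ (u : List (Fin n)) (c : Fin n) (r : List (Option (Fin n))),
      r.head?.all Option.isNone →
      (pairScanner n).insert (u.map some ++ r) (some c) =
        ((wordScanner n).insert u c).map some ++ r := by
    intro u c r hr
    induction u with
    | nil =>
      rcases r with _ | ⟨_ | a, r⟩
      · rfl
      · rfl
      · simp at hr
    | cons t u ih =>
      rw [List.map_cons, List.cons_append, Scanner.insert, Scanner.insert, ih]
      have h1 : (pairScanner n).jump (some t) (some c) = (wordScanner n).jump t c := rfl
      rw [h1]
      split_ifs <;> rfl
  have key : ∀ (l u : List (Fin n)) (r : List (Option (Fin n))), r.head?.all Option.isNone →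
      (l.map some).foldl (pairScanner n).insert (u.map some ++ r) =
        (l.foldl (wordScanner n).insert u).map some ++ r := by
    intro l
    induction l with
    | nil => intro u r _; rfl
    | cons c l ih =>
      intro u r hr
      rw [List.map_cons, List.foldl_cons, ins _ _ _ hr, ih _ _ hr]
      rfl
  rw [Scanner.sort, joinPair, List.foldl_append, List.foldl_cons]
  have h1 := key u [] [] rfl
  simp only [List.map_nil, List.append_nil] at h1
  rw [h1]
  have h2 : ∀ l : List (Option (Fin n)), (pairScanner n).insert l none = none :: l := by
    rintro (_ | ⟨t, l⟩)
    · rfl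
    · rw [Scanner.insert, if_neg]
      cases t <;> simp [scanner]
  rw [h2]
  exact key v [] (none :: _) rfl

/-! ### A stack machine for the algorithm -/

open Turing

/-- The stacks of the machine: three stacks of letters and an output stack. -/
inductive Stk
  | A | B | C | O
  deriving DecidableEq

instance : Fintype Stk := ⟨{.A, .B, .C, .O}, fun k => by cases k <;> simp⟩

/-- Instructions for a program with three stacks of letters and an output bit. -/
inductive Ins (Γ Q : Type)
  | pop (k : Stk) (hk : k ≠ .O) (f : Option Γ → Q)
  | push (k : Stk) (hk : k ≠ .O) (c : Γ) (q : Q)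
  | answer (b : Bool) (q : Q)
  | halt

namespace Ins

variable {Γ Q : Type}

/-- The alphabets of the stacks. -/
abbrev Alphabet (Γ : Type) : Stk → Type
  | .O => Bool
  | _ => Γ

/-- The contents of the stacks. -/
def contents (a b c : List Γ) (o : List Bool) : ∀ k, List (Alphabet Γ k)
  | .A => a
  | .B => b
  | .C => c
  | .O => o

/-- The statement that performs an instruction. -/
def toStmt : Ins Γ Q → TM2.Stmt (Alphabet Γ) Q (Option Γ)
  | .pop .A _ f => .pop .A (fun _ v => v) (.goto f)
  | .pop .B _ f => .pop .B (fun _ v => v) (.goto f)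
  | .pop .C _ f => .pop .C (fun _ v => v) (.goto f)
  | .pop .O h _ => (h rfl).elim
  | .push .A _ c q => .push .A (fun _ => c) (.goto fun _ => q)
  | .push .B _ c q => .push .B (fun _ => c) (.goto fun _ => q)
  | .push .C _ c q => .push .C (fun _ => c) (.goto fun _ => q)
  | .push .O h _ _ => (h rfl).elim
  | .answer b q => .push .O (fun _ => b) (.goto fun _ => q)
  -- The configuration required by `haltList` has the initial internal state.
  | .halt => .load (fun _ => none) .halt

end Ins

open Ins

section runs

variable {Γ Q : Type} {prog : Q → Ins Γ Q}

/-- A configuration of a program: the label and the stacks. -/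
structure Conf (Γ Q : Type) where
  label : Q
  a : List Γ
  b : List Γ
  c : List Γ
  o : List Bool

/-- The configuration of the machine, with its internal state. -/
def Conf.toCfg (x : Conf Γ Q) (v : Option Γ) : TM2.Cfg (Alphabet Γ) Q (Option Γ) :=
  ⟨some x.label, v, contents x.a x.b x.c x.o⟩

/-- A step of the machine that executes a program. -/
abbrev machineStep (prog : Q → Ins Γ Q) :
    TM2.Cfg (Alphabet Γ) Q (Option Γ) → Option (TM2.Cfg (Alphabet Γ) Q (Option Γ)) :=
  TM2.step fun q => (prog q).toStmt

/-- The machine takes `x` to `y` in at most `k` steps. -/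
def Runs (prog : Q → Ins Γ Q) (k : ℕ) (x y : Conf Γ Q) : Prop :=
  ∀ v, ∃ j ≤ k, ∃ v', (flip bind (machineStep prog))^[j] (some (x.toCfg v)) =
    some (y.toCfg v')

theorem Runs.refl (x : Conf Γ Q) : Runs prog 0 x x := fun v => ⟨0, le_rfl, v, rfl⟩

theorem Runs.trans {k l m : ℕ} {x y z : Conf Γ Q} (h : Runs prog k x y) (h' : Runs prog l y z)
    (hm : k + l ≤ m) : Runs prog m x z := by
  intro v
  obtain ⟨i, hi, w, hx⟩ := h v
  obtain ⟨j, hj, w', hy⟩ := h' w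
  exact ⟨j + i, by omega, w', by rw [Function.iterate_add_apply, hx, hy]⟩

theorem Runs.mono {k m : ℕ} {x y : Conf Γ Q} (h : Runs prog k x y) (hm : k ≤ m) :
    Runs prog m x y := h.trans (.refl y) hm

theorem Runs.cast {k : ℕ} {x y z : Conf Γ Q} (h : Runs prog k x y) (e : y = z) :
    Runs prog k x z := e ▸ h

theorem runs_of_step {x y : Conf Γ Q}
    (h : ∀ v, ∃ v', machineStep prog (x.toCfg v) = some (y.toCfg v')) :
    Runs prog 1 x y := fun v => by
  obtain ⟨v', hv⟩ := h v
  exact ⟨1, le_rfl, v', hv⟩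

theorem contents_update_A (a b c a' : List Γ) (o : List Bool) :
    Function.update (contents a b c o) Stk.A a' = contents a' b c o := by
  funext k; cases k <;> rfl

theorem contents_update_B (a b c a' : List Γ) (o : List Bool) :
    Function.update (contents a b c o) Stk.B a' = contents a a' c o := by
  funext k; cases k <;> rfl

theorem contents_update_C (a b c a' : List Γ) (o : List Bool) :
    Function.update (contents a b c o) Stk.C a' = contents a b a' o := by
  funext k; cases k <;> rfl

theorem contents_update_O (a b c : List Γ) (o o' : List Bool) :
    Function.update (contents a b c o) Stk.O o' = contents a b c o' := by
  funext k; cases k <;> rfl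

variable {q q' : Q} {f : Option Γ → Q} {a b c a' : List Γ} {o : List Bool}
  {e : Γ}

theorem runs_pop_A (h : prog q = .pop .A (by simp) f) (hq : f a.head? = q')
    (ht : a.tail = a') : Runs prog 1 ⟨q, a, b, c, o⟩ ⟨q', a', b, c, o⟩ :=
  runs_of_step fun v => ⟨a.head?, by
    subst hq ht
    simp only [Conf.toCfg, machineStep, TM2.step, h, toStmt, TM2.stepAux]
    erw [contents_update_A]
    rfl⟩

theorem runs_pop_B (h : prog q = .pop .B (by simp) f) (hq : f b.head? = q')
    (ht : b.tail = a') : Runs prog 1 ⟨q, a, b, c, o⟩ ⟨q', a, a', c, o⟩ :=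
  runs_of_step fun v => ⟨b.head?, by
    subst hq ht
    simp only [Conf.toCfg, machineStep, TM2.step, h, toStmt, TM2.stepAux]
    erw [contents_update_B]
    rfl⟩

theorem runs_pop_C (h : prog q = .pop .C (by simp) f) (hq : f c.head? = q')
    (ht : c.tail = a') : Runs prog 1 ⟨q, a, b, c, o⟩ ⟨q', a, b, a', o⟩ :=
  runs_of_step fun v => ⟨c.head?, by
    subst hq ht
    simp only [Conf.toCfg, machineStep, TM2.step, h, toStmt, TM2.stepAux]
    erw [contents_update_C]
    rfl⟩

theorem runs_push_A (h : prog q = .push .A (by simp) e q') :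
    Runs prog 1 ⟨q, a, b, c, o⟩ ⟨q', e :: a, b, c, o⟩ :=
  runs_of_step fun v => ⟨v, by
    simp only [Conf.toCfg, machineStep, TM2.step, h, toStmt, TM2.stepAux]
    erw [contents_update_A]
    rfl⟩

theorem runs_push_B (h : prog q = .push .B (by simp) e q') :
    Runs prog 1 ⟨q, a, b, c, o⟩ ⟨q', a, e :: b, c, o⟩ :=
  runs_of_step fun v => ⟨v, by
    simp only [Conf.toCfg, machineStep, TM2.step, h, toStmt, TM2.stepAux]
    erw [contents_update_B]
    rfl⟩

theorem runs_push_C (h : prog q = .push .C (by simp) e q') :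
    Runs prog 1 ⟨q, a, b, c, o⟩ ⟨q', a, b, e :: c, o⟩ :=
  runs_of_step fun v => ⟨v, by
    simp only [Conf.toCfg, machineStep, TM2.step, h, toStmt, TM2.stepAux]
    erw [contents_update_C]
    rfl⟩

theorem runs_answer {r : Bool} (h : prog q = .answer r q') :
    Runs prog 1 ⟨q, a, b, c, o⟩ ⟨q', a, b, c, r :: o⟩ :=
  runs_of_step fun v => ⟨v, by
    simp only [Conf.toCfg, machineStep, TM2.step, h, toStmt, TM2.stepAux]
    erw [contents_update_O]
    rfl⟩

theorem Runs.halt {k : ℕ} {x : Conf Γ Q} (h : Runs prog k x ⟨q, a, b, c, o⟩)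
    (hq : prog q = .halt) (v : Option Γ) :
    ∃ j ≤ k + 1, (flip bind (machineStep prog))^[j] (some (x.toCfg v)) =
      some ⟨none, none, contents a b c o⟩ := by
  obtain ⟨j, hj, v', hx⟩ := h v
  refine ⟨1 + j, by omega, ?_⟩
  rw [Function.iterate_add_apply, hx]
  change machineStep prog (Conf.toCfg ⟨q, a, b, c, o⟩ v') = _
  simp only [Conf.toCfg, machineStep, TM2.step, hq, toStmt, TM2.stepAux]

end runs

/-- The labels of the program. -/
inductive Lbl (Γ S : Type)
  | scan (d : Bool) (s : S) (ch : Bool)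
  | emit (d : Bool) (s : S) (ch : Bool) (c : Γ)
  | sort
  | shift (c : Γ)
  | hold (c t : Γ)
  | back (c t : Γ)
  | place (c : Γ)
  | unshift
  | restore (t : Γ)
  | fin
  | finPush (t : Γ)
  | split
  | splitPush (t : Γ)
  | collect
  | collectPush (t : Γ)
  | compare (ok : Bool)
  | check (ok : Bool) (t : Γ)
  | drain (ok : Bool)
  | answer (ok : Bool)
  | halt
  deriving Fintype

section program

variable {Γ S : Type} [DecidableEq Γ] (P : Scanner Γ S)

/-- The program: it normalizes the word on the first stack by passes in both directions, sorts the
result into the second stack, and then either moves the result back, or, given a test for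
separators, compares the words before and after the separator. -/
def prog (mode : Option (Γ → Bool)) : Lbl Γ S → Ins Γ (Lbl Γ S)
  | .scan false s ch => .pop .A (by simp) fun
    | some c => if P.drop s c then .scan false s true else .emit false (P.next s c) ch c
    | none => .scan true P.init ch
  | .scan true s ch => .pop .B (by simp) fun
    | some c => if P.drop s c then .scan true s true else .emit true (P.next s c) ch c
    -- The flag `ch` records whether either pass of the round has dropped a letter.
    | none => if ch then .scan false P.init false else .sort
  | .emit false s ch c => .push .B (by simp) c (.scan false s ch)
  | .emit true s ch c => .push .A (by simp) c (.scan true s ch)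
  | .sort => .pop .A (by simp) fun
    | some c => .shift c
    | none => if mode.isSome then .split else .fin
  | .shift c => .pop .B (by simp) fun
    | some t => if P.jump t c then .hold c t else .back c t
    | none => .place c
  | .hold c t => .push .C (by simp) t (.shift c)
  | .back c t => .push .B (by simp) t (.place c)
  | .place c => .push .B (by simp) c .unshift
  | .unshift => .pop .C (by simp) fun
    | some t => .restore t
    | none => .sort
  | .restore t => .push .B (by simp) t .unshift
  | .fin => .pop .B (by simp) fun
    | some t => .finPush t
    | none => .halt
  | .finPush t => .push .A (by simp) t .fin
  | .split => .pop .B (by simp) fun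
    | some t => if mode.any (· t) then .collect else .splitPush t
    | none => .halt
  | .splitPush t => .push .A (by simp) t .split
  | .collect => .pop .B (by simp) fun
    | some t => .collectPush t
    | none => .compare true
  | .collectPush t => .push .C (by simp) t .collect
  | .compare ok => .pop .A (by simp) fun
    | some t => .check ok t
    | none => .drain ok
  | .check ok t => .pop .C (by simp) fun
    | some t' => .compare (ok && decide (t = t'))
    | none => .compare false
  -- A mismatch only clears the flag: both words are still read to the end, since every stack but
  -- the output must be empty at the halt.
  | .drain ok => .pop .C (by simp) fun
    | some _ => .drain false
    | none => .answer ok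
  | .answer ok => .answer ok .halt
  | .halt => .halt

variable {P} {mode : Option (Γ → Bool)} (a b r : List Γ) (o : List Bool)

theorem runs_scan_false (l acc : List Γ) (s : S) (ch : Bool) :
    Runs (prog P mode) (2 * l.length + 1) ⟨.scan false s ch, l, acc, r, o⟩
      ⟨.scan true P.init (ch || decide ((P.scan s l acc).length < l.length + acc.length)), [],
        P.scan s l acc, r, o⟩ := by
  induction l generalizing acc s ch with
  | nil =>
    rw [show (ch || _) = ch by simp [Scanner.scan]]
    exact runs_pop_A rfl rfl rfl
  | cons c l ih =>
    have hle := P.length_scan_le s l acc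
    by_cases h : P.drop s c
    · refine Runs.trans (runs_pop_A rfl (by simp [h]) rfl) (y := ⟨.scan false s true, l, acc, r, o⟩)
        (l := 2 * l.length + 1) ?_ (by simp; omega)
      have := ih acc s true
      rw [show P.scan s (c :: l) acc = P.scan s l acc by simp [Scanner.scan, h],
        show (ch || _) = true by simp; omega]
      rwa [Bool.true_or] at this
    · refine Runs.trans (runs_pop_A rfl (by simp [h]) rfl)
        (y := ⟨.emit false (P.next s c) ch c, l, acc, r, o⟩) (l := 2 * l.length + 2)
        ?_ (by simp; omega)
      refine Runs.trans (runs_push_B rfl) (l := 2 * l.length + 1) ?_ (by omega)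
      rw [show P.scan s (c :: l) acc = P.scan (P.next s c) l (c :: acc) by simp [Scanner.scan, h],
        show (c :: l).length + acc.length = l.length + (c :: acc).length by simp; omega]
      exact ih (c :: acc) (P.next s c) ch

theorem runs_scan_true (l acc : List Γ) (s : S) (ch : Bool) :
    Runs (prog P mode) (2 * l.length + 1) ⟨.scan true s ch, acc, l, r, o⟩
      ⟨if ch || decide ((P.scan s l acc).length < l.length + acc.length) then
        .scan false P.init false else .sort, P.scan s l acc, [], r, o⟩ := by
  induction l generalizing acc s ch with
  | nil =>
    rw [show (ch || _) = ch by simp [Scanner.scan]]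
    exact runs_pop_B rfl rfl rfl
  | cons c l ih =>
    have hle := P.length_scan_le s l acc
    by_cases h : P.drop s c
    · refine Runs.trans (runs_pop_B rfl (by simp [h]) rfl) (y := ⟨.scan true s true, acc, l, r, o⟩)
        (l := 2 * l.length + 1) ?_ (by simp; omega)
      have := ih acc s true
      rw [show P.scan s (c :: l) acc = P.scan s l acc by simp [Scanner.scan, h],
        show (ch || _) = true by simp; omega]
      rwa [Bool.true_or] at this
    · refine Runs.trans (runs_pop_B rfl (by simp [h]) rfl)
        (y := ⟨.emit true (P.next s c) ch c, acc, l, r, o⟩) (l := 2 * l.length + 2)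
        ?_ (by simp; omega)
      refine Runs.trans (runs_push_A rfl) (l := 2 * l.length + 1) ?_ (by omega)
      rw [show P.scan s (c :: l) acc = P.scan (P.next s c) l (c :: acc) by simp [Scanner.scan, h],
        show (c :: l).length + acc.length = l.length + (c :: acc).length by simp; omega]
      exact ih (c :: acc) (P.next s c) ch

/-- A round costs at most `2 * (2 * l.length + 1)` steps, and every round but the last shortens the
word. -/
theorem runs_norm (l : List Γ) : Runs (prog P mode) ((4 * l.length + 2) * (l.length + 1))
    ⟨.scan false P.init false, l, [], [], o⟩ ⟨.sort, P.norm l, [], [], o⟩ := by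
  induction h : l.length using Nat.strong_induction_on generalizing l with
  | _ k ih =>
    subst h
    have h1 := P.length_pass_le l
    have h2 := P.length_pass_le (P.pass l)
    have key : Runs (prog P mode) (4 * l.length + 2) ⟨.scan false P.init false, l, [], [], o⟩
        ⟨if (P.pass (P.pass l)).length < l.length then .scan false P.init false else .sort,
          P.pass (P.pass l), [], [], o⟩ := by
      refine (runs_scan_false [] o l [] P.init false).trans
        (runs_scan_true [] o (P.pass l) [] P.init _) (by omega) |>.cast ?_
      congr 1
      refine if_congr ?_ rfl rfl
      simp only [Bool.false_or, Bool.or_eq_true, decide_eq_true_eq, List.length_nil, add_zero]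
      simp only [Scanner.pass] at h1 h2 ⊢
      omega
    rw [Scanner.norm]
    split_ifs with h
    · rw [if_pos h] at key
      refine key.trans (ih _ h _ rfl) ?_
      calc _ ≤ (4 * l.length + 2) + (4 * l.length + 2) * l.length := by gcongr; omega
        _ = _ := by ring
    · rw [if_neg h] at key
      exact key.mono (Nat.le_mul_of_pos_right _ (by omega))

theorem runs_unshift (u : List Γ) : Runs (prog P mode) (2 * r.length + 1)
    ⟨.unshift, a, u, r, o⟩ ⟨.sort, a, r.reverse ++ u, [], o⟩ := by
  induction r generalizing u with
  | nil => exact runs_pop_C rfl rfl rfl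
  | cons t r ih =>
    refine Runs.trans (runs_pop_C rfl rfl rfl) (l := 2 * r.length + 2)
      (y := ⟨.restore t, a, u, r, o⟩) ?_ (by simp; omega)
    refine Runs.trans (runs_push_B rfl) (l := 2 * r.length + 1) ?_ (by omega)
    simpa using ih (t :: u)

/-- The stack `r` holds the letters already moved out of the way. A letter of `u` costs at most four
steps, out to the third stack and back; a letter already held costs two. -/
theorem runs_insert (u : List Γ) (c : Γ) : Runs (prog P mode) (4 * u.length + 2 * r.length + 4)
    ⟨.shift c, a, u, r, o⟩ ⟨.sort, a, r.reverse ++ P.insert u c, [], o⟩ := by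
  induction u generalizing r with
  | nil =>
    refine Runs.trans (runs_pop_B rfl rfl rfl) (l := 2 * r.length + 2)
      (y := ⟨.place c, a, [], r, o⟩) ?_ (by simp; omega)
    exact Runs.trans (runs_push_B rfl) (runs_unshift a r o [c]) (by omega)
  | cons t u ih =>
    by_cases h : P.jump t c
    · refine Runs.trans (runs_pop_B rfl (by simp [h]) rfl)
        (l := 4 * u.length + 2 * r.length + 7) (y := ⟨.hold c t, a, u, r, o⟩) ?_ (by simp; omega)
      refine Runs.trans (runs_push_C rfl) (ih (t :: r) |>.cast ?_) (by simp; omega)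
      simp [Scanner.insert, h]
    · refine Runs.trans (runs_pop_B rfl (by simp [h]) rfl)
        (l := 2 * r.length + 3) (y := ⟨.back c t, a, u, r, o⟩) ?_ (by simp; omega)
      refine Runs.trans (runs_push_B rfl) (l := 2 * r.length + 2) ?_ (by omega)
      refine Runs.trans (runs_push_B rfl) (runs_unshift a r o (c :: t :: u) |>.cast ?_) (by omega)
      simp [Scanner.insert, h]

theorem runs_sort (l u : List Γ) :
    Runs (prog P mode) (l.length * (4 * (u.length + l.length) + 5) + 1) ⟨.sort, l, u, [], o⟩
      ⟨if mode.isSome then .split else .fin, [], l.foldl P.insert u, [], o⟩ := by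
  induction l generalizing u with
  | nil => exact Runs.mono (runs_pop_A rfl rfl rfl) (by simp)
  | cons c l ih =>
    refine Runs.trans (runs_pop_A rfl rfl rfl) (y := ⟨.shift c, l, u, [], o⟩)
      (Runs.trans (runs_insert l [] o u c) (ih _) le_rfl) ?_
    simp only [Scanner.length_insert, List.length_cons, List.length_nil]
    ring_nf
    omega

theorem runs_fin : Runs (prog P mode) (2 * b.length + 1) ⟨.fin, a, b, r, o⟩
    ⟨.halt, b.reverse ++ a, [], r, o⟩ := by
  induction b generalizing a with
  | nil => exact runs_pop_B rfl rfl rfl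
  | cons t b ih =>
    refine Runs.trans (runs_pop_B rfl rfl rfl) (l := 2 * b.length + 2)
      (y := ⟨.finPush t, a, b, r, o⟩) ?_ (by simp; omega)
    refine Runs.trans (runs_push_A rfl) (l := 2 * b.length + 1) ?_ (by omega)
    simpa using ih (t :: a)

theorem runs_split {sep : Γ → Bool} (t : Γ) (ht : sep t = true) (u : List Γ)
    (hu : ∀ e ∈ u, sep e = false) :
    Runs (prog P (some sep)) (2 * u.length + 1) ⟨.split, a, u ++ t :: b, r, o⟩
      ⟨.collect, u.reverse ++ a, b, r, o⟩ := by
  induction u generalizing a with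
  | nil => exact runs_pop_B rfl (by simp [ht]) rfl
  | cons e u ih =>
    refine Runs.trans (runs_pop_B rfl (by simp [hu]) rfl) (l := 2 * u.length + 2)
      (y := ⟨.splitPush e, a, u ++ t :: b, r, o⟩) ?_ (by simp; omega)
    refine Runs.trans (runs_push_A rfl) (l := 2 * u.length + 1) ?_ (by omega)
    simpa using ih (e :: a) fun e he => hu e (by simp [he])

theorem runs_collect : Runs (prog P mode) (2 * b.length + 1) ⟨.collect, a, b, r, o⟩
    ⟨.compare true, a, [], b.reverse ++ r, o⟩ := by
  induction b generalizing r with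
  | nil => exact runs_pop_B rfl rfl rfl
  | cons t b ih =>
    refine Runs.trans (runs_pop_B rfl rfl rfl) (l := 2 * b.length + 2)
      (y := ⟨.collectPush t, a, b, r, o⟩) ?_ (by simp; omega)
    refine Runs.trans (runs_push_C rfl) (l := 2 * b.length + 1) ?_ (by omega)
    simpa using ih (t :: r)

theorem runs_drain (ok : Bool) : Runs (prog P mode) (r.length + 1) ⟨.drain ok, a, b, r, o⟩
    ⟨.answer (ok && decide ([] = r)), a, b, [], o⟩ := by
  induction r generalizing ok with
  | nil =>
    rw [decide_eq_true rfl, Bool.and_true]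
    exact runs_pop_C rfl rfl rfl
  | cons t r ih =>
    refine Runs.trans (runs_pop_C rfl rfl rfl) (l := r.length + 1)
      (y := ⟨.drain false, a, b, r, o⟩) ?_ (by simp; omega)
    simpa using ih false

theorem runs_compare (ok : Bool) : Runs (prog P mode) (2 * a.length + r.length + 2)
    ⟨.compare ok, a, b, r, o⟩ ⟨.answer (ok && decide (a = r)), [], b, [], o⟩ := by
  induction a generalizing ok r with
  | nil =>
    exact Runs.trans (runs_pop_A rfl rfl rfl) (y := ⟨.drain ok, [], b, r, o⟩)
      (runs_drain [] b r o ok) (by simp; omega)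
  | cons t a ih =>
    refine Runs.trans (runs_pop_A rfl rfl rfl) (y := ⟨.check ok t, a, b, r, o⟩)
      (l := 2 * a.length + r.length + 3) ?_ (by simp; omega)
    cases r with
    | nil =>
      refine Runs.trans (runs_pop_C rfl rfl rfl) (y := ⟨.compare false, a, b, [], o⟩)
        (l := 2 * a.length + 2) ?_ (by simp; omega)
      simpa using ih [] false
    | cons t' r =>
      refine Runs.trans (runs_pop_C rfl rfl rfl)
        (y := ⟨.compare (ok && decide (t = t')), a, b, r, o⟩)
        (l := 2 * a.length + r.length + 2) ?_ (by simp; omega)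
      simpa [Bool.and_assoc, Bool.decide_and] using ih r (ok && decide (t = t'))

end program

/-! ### Polynomial time bounds -/

section machine

variable {Γ S : Type} [DecidableEq Γ] [Fintype Γ] [Fintype S]

/-- The machine that executes the program, with output on the stack `k`. -/
def machine (P : Scanner Γ S) (mode : Option (Γ → Bool)) (k : Stk) : FinTM2 where
  K := Stk
  k₀ := .A
  k₁ := k
  Γ := Alphabet Γ
  Λ := Lbl Γ S
  main := .scan false P.init false
  σ := Option Γ
  initialState := none
  Γk₀Fin := ‹Fintype Γ›
  m q := (prog P mode q).toStmt

variable {P : Scanner Γ S} {mode : Option (Γ → Bool)}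

theorem initList_machine (k : Stk) (l : List Γ) : initList (machine P mode k) l =
    Conf.toCfg ⟨.scan false P.init false, l, [], [], []⟩ none := by
  refine congrArg (TM2.Cfg.mk _ _) (funext fun j => ?_)
  cases j <;> rfl

theorem haltList_machine_A (l : List Γ) : haltList (machine P mode .A) l =
    (⟨none, none, contents l [] [] []⟩ : TM2.Cfg (Alphabet Γ) (Lbl Γ S) (Option Γ)) := by
  refine congrArg (TM2.Cfg.mk _ _) (funext fun j => ?_)
  cases j <;> rfl

theorem haltList_machine_O (l : List Bool) : haltList (machine P mode .O) l =
    (⟨none, none, contents [] [] [] l⟩ : TM2.Cfg (Alphabet Γ) (Lbl Γ S) (Option Γ)) := by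
  refine congrArg (TM2.Cfg.mk _ _) (funext fun j => ?_)
  cases j <;> rfl

/-- A bound for the running time of the machine. -/
noncomputable def timeBound : Polynomial ℕ := 8 * .X ^ 2 + 20 * .X + 20

/-- The constant is `19`, not the `20` of `timeBound`, because the halting instruction takes one
more step. -/
theorem polyTime_of_runs {α β Δ : Type} {ea : α → List Γ} {eb : β → List Δ} {f : α → β} {k : Stk}
    (e : Alphabet Γ k ≃ Δ)
    (hf : ∀ x, ∃ b, Runs (prog P mode) (8 * (ea x).length ^ 2 + 20 * (ea x).length + 19)
      ⟨.scan false P.init false, ea x, [], [], []⟩ b ∧ prog P mode b.label = .halt ∧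
      (⟨none, none, contents b.a b.b b.c b.o⟩ : TM2.Cfg (Alphabet Γ) (Lbl Γ S) (Option Γ)) =
        haltList (machine P mode k) ((eb (f x)).map e.symm)) :
    PolyTime ea eb f := by
  refine ⟨⟨⟨machine P mode k, Equiv.refl Γ, e⟩, timeBound, fun x => Classical.choice ?_⟩⟩
  obtain ⟨b, hb, hq, hs⟩ := hf x
  obtain ⟨j, hj, hx⟩ := hb.halt hq none
  refine ⟨⟨⟨j, ?_⟩, hj.trans (by simp [timeBound])⟩⟩
  refine Eq.trans ?_ (hx.trans (congrArg some hs))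
  exact congrArg (fun c => (flip bind (machineStep (prog P mode)))^[j] (some c))
    ((congrArg (initList (machine P mode k)) (List.map_id _)).trans (initList_machine k _))

theorem polyTime_norm_sort (P : Scanner Γ S) : PolyTime id id
    fun l : List Γ => (P.sort (P.norm l)).reverse := by
  refine polyTime_of_runs (mode := none) (P := P) (k := .A) (Equiv.refl Γ) fun l =>
    ⟨⟨.halt, (P.sort (P.norm l)).reverse, [], [], []⟩, ?_, rfl, ?_⟩
  · have h := P.length_norm_le l
    have h1 := (runs_norm (P := P) (mode := none) [] l).trans (runs_sort [] (P.norm l) []) le_rfl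
    have h2 := h1.trans (runs_fin [] _ [] []) le_rfl
    rw [List.append_nil] at h2
    refine h2.mono ?_
    change _ + (2 * (P.sort (P.norm l)).length + 1) ≤ _
    rw [P.length_sort]
    simp only [id]
    have : (P.norm l).length * (4 * ((P.norm l).length) + 5) ≤ l.length * (4 * l.length + 5) := by
      gcongr
    simp only [List.length_nil, zero_add]
    nlinarith
  · exact (congrArg (fun m => TM2.Cfg.mk none none (contents m [] [] [])) (List.map_id _).symm).trans
      (haltList_machine_A _).symm

theorem polyTime_compare {α : Type} (P : Scanner Γ S) (sep : Γ → Bool) (ea : α → List Γ)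
    (u v : α → List Γ) (t : Γ) (ht : sep t = true)
    (h : ∀ x, P.sort (P.norm (ea x)) = u x ++ t :: v x) (hu : ∀ x, ∀ c ∈ u x, sep c = false) :
    PolyTime ea Computability.encodeBool fun x => decide (u x = v x) := by
  refine polyTime_of_runs (mode := some sep) (P := P) (k := .O) (Equiv.refl Bool) fun x =>
    ⟨⟨.halt, [], [], [], [decide (u x = v x)]⟩, ?_, rfl, ?_⟩
  · have hle := P.length_norm_le (ea x)
    have h1 := (runs_norm (P := P) (mode := some sep) [] (ea x)).trans
      (runs_sort [] (P.norm (ea x)) []) le_rfl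
    rw [show List.foldl P.insert [] _ = u x ++ t :: v x from h x] at h1
    have h2 := (h1.trans (runs_split [] (v x) [] [] t ht (u x) (hu x)) le_rfl).trans
      (runs_collect _ _ _ _) le_rfl
    have h3 := (h2.trans (runs_compare _ _ _ _ _) le_rfl).trans (runs_answer rfl) le_rfl
    simp only [List.append_nil, List.reverse_inj, Bool.true_and] at h3
    refine h3.mono ?_
    have hl := congrArg List.length (h x)
    rw [P.length_sort] at hl
    have : (P.norm (ea x)).length * (4 * ((P.norm (ea x)).length) + 5) ≤
        (ea x).length * (4 * (ea x).length + 5) := by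
      gcongr
    simp only [List.length_append, List.length_cons] at hl
    simp only [List.length_nil, List.length_reverse, zero_add]
    nlinarith
  · exact (haltList_machine_O _).symm

end machine

theorem norm_sort_joinPair {n : ℕ} (u v : List (Fin n)) :
    (pairScanner n).sort ((pairScanner n).norm (joinPair u v)) =
      joinPair (reducedForm (.ofList v)).toList.reverse
        (reducedForm (.ofList u)).toList.reverse := by
  rw [norm_joinPair, sort_joinPair]
  simp [reducedForm]

end CIMonoid

theorem mainTheorem7 (n : ℕ) :
    (∃ red : CIMonoid.Word n → CIMonoid.Word n,
      (∀ w u : CIMonoid.Word n, CIMonoid.IsReducedForm u w ↔ u = red w) ∧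
      CIMonoid.PolyTime CIMonoid.encodeWord CIMonoid.encodeWord red) ∧
    (∃ dec : CIMonoid.Word n × CIMonoid.Word n → Bool,
      (∀ u v : CIMonoid.Word n, dec (u, v) = true ↔ CIMonoid.toM u = CIMonoid.toM v) ∧
      CIMonoid.PolyTime CIMonoid.encodePair Computability.encodeBool dec) := by
  refine ⟨⟨CIMonoid.reducedForm, fun _ _ => CIMonoid.isReducedForm_iff,
    CIMonoid.polyTime_norm_sort (CIMonoid.wordScanner n)⟩, _, fun u v => ?_,
    CIMonoid.polyTime_compare (CIMonoid.pairScanner n) Option.isNone CIMonoid.encodePair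
      -- The second word comes first because sorting exchanges the two words, while normalization,
      -- made of double passes, keeps their order.
      (fun p => (CIMonoid.reducedForm p.2).toList.reverse.map some)
      (fun p => (CIMonoid.reducedForm p.1).toList.reverse.map some) none rfl
      (fun p => CIMonoid.norm_sort_joinPair p.1.toList p.2.toList) (by simp)⟩
  rw [decide_eq_true_iff, ← CIMonoid.reducedForm_eq_iff,
    (List.map_injective_iff.2 (Option.some_injective _)).eq_iff, List.reverse_inj,
    FreeMonoid.toList.injective.eq_iff, eq_comm]
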